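/- Let $\mathbf F=\mathbf F_q$ be a finite field, $n\ge 0$, $GL_n=GL_n(\mathbf F)$, and fix a non-trivial character $\chi_0$ of the additive group of $\mathbf F$. All representations are finite-dimensional and complex; a character of $GL_n$ is a one-dimensional representation; $\pi<\rho$ means that $\pi$ is equivalent to a subrepresentation of $\rho$. *U-rank.* A standard matrix subgroup $U\cong M_{a,b}(\mathbf F)$ of $GL_m$ consists of the matrices $I+X$ with $X$ an arbitrary matrix supported in the off-diagonal block in position $(i,j)$, $i<j$ (of size $a\times b$), of some block upper triangular parabolic subgroup of $GL_m$. Every character of $U$ has the form $X\mapsto\chi_0(\operatorname{tr}(TX))$ for a unique $T\in M_{b,a}(\mathbf F)$, and its rank is the rank of $T$. For a representation $\rho$ of $GL_m$, let $\operatorname{rank}_U(\rho)$ be the largest rank of a character of $U$ that appears in $\rho|_U$. The $U$-rank of $\rho$ is the maximum of $\operatorname{rank}_U(\rho)$ over all standard matrix subgroups $U$, and $\rho$ has low $U$-rank if $\operatorname{rank}_U(\rho)<\min(a,b)$ for some standard matrix subgroup $U\cong M_{a,b}(\mathbf F)$. *Asymptotic rank.* For $m\ge n$ embed $GL_n$ in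 $GL_m$ by $A\mapsto\begin{pmatrix}A&0\\0&I\end{pmatrix}$. A representation $\pi$ of $GL_n$ has asymptotic rank $\le k$ if for all sufficiently large $m$ there is a representation $\rho$ of $GL_m$ which has low $U$-rank, and $U$-rank $\le k$, such that $\pi<\rho|_{GL_n}$. The asymptotic rank of $\pi$ is the least such $k$ ($\infty$ if there is none). *Tensor rank.* Let $GL_n$ act on the space $L^2(\mathbf F^n)$ of complex functions on $\mathbf F^n$ by $(gf)(y)=f(g^{-1}y)$. An irreducible representation $\nu$ of $GL_n$ has tensor rank $\le k$ if there are $0\le\ell\le k$, irreducible subrepresentations $\tau_1,\dots,\tau_\ell$ of $L^2(\mathbf F^n)$ and a character $\chi$ of $GL_n$ such that $\nu<\chi\otimes\tau_1\otimes\cdots\otimes\tau_\ell$. An arbitrary representation has tensor rank $\le k$ if all its irreducible subrepresentations do. The tensor rank is the least such $k$ ($\infty$ if there is none). **Theorem 11.4 (Agreement between asymptotic and tensor ranks).** Assume $(n,q)\neq(2,2)$. Then for every representation $\pi$ of $GL_n(\mathbf F_q)$, the asymptotic rank of $\pi$ equals the tensor rank of $\pi$. -/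

import Mathlib

open Matrix

namespace GLRank

section Containment

variable {G : Type*} [Group G]
  {V : Type*} [AddCommGroup V] [Module ℂ V] {W : Type*} [AddCommGroup W] [Module ℂ W]

/-- `IsContained π ρ`, written `π < ρ` in the literature: the representation `π` is equivalent to
a subrepresentation of `ρ`, that is, it admits an injective intertwining map into `ρ`. -/
def IsContained (π : Representation ℂ G V) (ρ : Representation ℂ G W) : Prop :=
  ∃ f : π.IntertwiningMap ρ, Function.Injective f

/-- The twist `χ ⊗ ρ` of `ρ` by the character (one-dimensional representation) `χ`. -/
def twist (χ : G →* ℂˣ) (ρ : Representation ℂ G V) : Representation ℂ G V where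
  toFun g := (χ g : ℂ) • ρ g
  map_one' := by simp
  map_mul' g h := by ext v; simp [smul_smul, mul_comm]

end Containment

/-- The `ℓ`-fold tensor product `τ 0 ⊗ ⋯ ⊗ τ (ℓ - 1)` with the diagonal action of `G`
(the trivial representation on `ℂ` when `ℓ = 0`). -/
noncomputable def tensorProd {G : Type*} [Group G] {ℓ : ℕ} {V : Fin ℓ → Type*}
    [∀ i, AddCommGroup (V i)] [∀ i, Module ℂ (V i)] (τ : ∀ i, Representation ℂ G (V i)) :
    Representation ℂ G (PiTensorProduct ℂ V) :=
  PiTensorProduct.mapMonoidHom.comp (MonoidHom.pi τ)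

section StandardSubgroups

/-- The data of a standard matrix subgroup of `GL n`: two blocks of consecutive indices,
`row, …, row + a - 1` and `col, …, col + b - 1`, the first lying to the left of the second.
These are two diagonal blocks of a block upper triangular parabolic subgroup, and the subgroup is
`{I + X}` with `X` an arbitrary `a × b` matrix placed in the corresponding off-diagonal block. -/
structure StdBlock (n : ℕ) where
  a : ℕ
  b : ℕ
  row : ℕ
  col : ℕ
  row_le : row + a ≤ col
  col_le : col + b ≤ n

variable {F : Type*} [Field F] {n : ℕ}

namespace StdBlock

/-- The index in `Fin n` of the `i`-th row of the block. -/
def rowIdx (U : StdBlock n) (i : Fin U.a) : Fin n :=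
  ⟨U.row + i, by have := U.row_le; have := U.col_le; omega⟩

/-- The index in `Fin n` of the `j`-th column of the block. -/
def colIdx (U : StdBlock n) (j : Fin U.b) : Fin n :=
  ⟨U.col + j, by have := U.col_le; omega⟩

/-- The `n × n` matrix with the `a × b` matrix `X` in the block of `U` and zeros elsewhere. -/
def place (U : StdBlock n) (X : Matrix (Fin U.a) (Fin U.b) F) : Matrix (Fin n) (Fin n) F :=
  ∑ i, ∑ j, Matrix.single (U.rowIdx i) (U.colIdx j) (X i j)

theorem place_mul_place (U : StdBlock n) (X Y : Matrix (Fin U.a) (Fin U.b) F) :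
    U.place X * U.place Y = 0 := by
  simp only [place, Finset.sum_mul, Finset.mul_sum]
  refine Finset.sum_eq_zero fun i _ => Finset.sum_eq_zero fun j _ =>
    Finset.sum_eq_zero fun i' _ => Finset.sum_eq_zero fun j' _ => ?_
  apply Matrix.single_mul_single_of_ne
  intro h
  have h' := congrArg Fin.val h
  simp only [rowIdx, colIdx] at h'
  have := U.row_le
  omega

theorem place_neg (U : StdBlock n) (X : Matrix (Fin U.a) (Fin U.b) F) :
    U.place (-X) = -U.place X := by
  have h (p q : Fin n) (c : F) : Matrix.single p q (-c) = -Matrix.single p q c :=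
    (Matrix.singleAddMonoidHom p q).map_neg c
  simp [place, h]

/-- The element `I + X` of the standard matrix subgroup. -/
def elem (U : StdBlock n) (X : Matrix (Fin U.a) (Fin U.b) F) : GL (Fin n) F where
  val := 1 + U.place X
  inv := 1 + U.place (-X)
  val_inv := by
    simp [place_neg, mul_add, add_mul, place_mul_place]
  inv_val := by
    simp [place_neg, mul_add, add_mul, place_mul_place]

end StdBlock

variable {V : Type*} [AddCommGroup V] [Module ℂ V]

/-- The character `X ↦ χ₀ (trace (T X))` of the standard matrix subgroup `U ≅ M_{a,b}(F)` appears
in the restriction of `ρ` to `U`: there is a nonzero eigenvector with this eigencharacter. -/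
def CharAppears (χ₀ : AddChar F ℂ) (ρ : Representation ℂ (GL (Fin n) F) V) (U : StdBlock n)
    (T : Matrix (Fin U.b) (Fin U.a) F) : Prop :=
  ∃ v : V, v ≠ 0 ∧ ∀ X : Matrix (Fin U.a) (Fin U.b) F,
    ρ (U.elem X) v = χ₀ (T * X).trace • v

/-- `rank_U(ρ)`: the largest rank of a character of `U` that appears in the restriction of `ρ`
to `U`. -/
noncomputable def rankAt (χ₀ : AddChar F ℂ) (ρ : Representation ℂ (GL (Fin n) F) V)
    (U : StdBlock n) : ℕ :=
  sSup {r | ∃ T, CharAppears χ₀ ρ U T ∧ T.rank = r}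

/-- The `U`-rank of `ρ`: the largest of the numbers `rank_U(ρ)`, over all standard matrix
subgroups `U`. -/
noncomputable def uRank (χ₀ : AddChar F ℂ) (ρ : Representation ℂ (GL (Fin n) F) V) : ℕ :=
  sSup {r | ∃ U, rankAt χ₀ ρ U = r}

/-- `ρ` has low `U`-rank: for some standard matrix subgroup `U ≅ M_{a,b}(F)` we have
`rank_U(ρ) < min a b`. -/
def IsLowURank (χ₀ : AddChar F ℂ) (ρ : Representation ℂ (GL (Fin n) F) V) : Prop :=
  ∃ U : StdBlock n, rankAt χ₀ ρ U < min U.a U.b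

/-- The set of ranks in the definition of `rankAt` is bounded, so the supremum is a maximum. -/
theorem bddAbove_rankAt (χ₀ : AddChar F ℂ) (ρ : Representation ℂ (GL (Fin n) F) V)
    (U : StdBlock n) : BddAbove {r | ∃ T, CharAppears χ₀ ρ U T ∧ T.rank = r} := by
  refine ⟨U.b, ?_⟩
  rintro _ ⟨T, -, rfl⟩
  simpa using T.rank_le_card_height

/-- The set of ranks in the definition of `uRank` is bounded, so the supremum is a maximum. -/
theorem bddAbove_uRank (χ₀ : AddChar F ℂ) (ρ : Representation ℂ (GL (Fin n) F) V) :
    BddAbove {r | ∃ U, rankAt χ₀ ρ U = r} := by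
  refine ⟨n, ?_⟩
  rintro _ ⟨U, rfl⟩
  refine csSup_le' ?_
  rintro _ ⟨T, -, rfl⟩
  have h : T.rank ≤ U.b := by simpa using T.rank_le_card_height
  have := U.col_le
  omega

end StandardSubgroups

section AsymptoticRank

variable {F : Type*} [Field F] {n : ℕ}

/-- The block embedding `GL n → GL m`, `A ↦ diag(A, I)`, for `n ≤ m`. -/
def blockEmb (F : Type*) [Field F] {n m : ℕ} (h : n ≤ m) : GL (Fin n) F →* GL (Fin m) F :=
  Units.map
    { toFun := fun A => Matrix.reindexRingEquiv F
        (finSumFinEquiv.trans (finCongr (Nat.add_sub_of_le h)))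
        (Matrix.fromBlocks A 0 0 (1 : Matrix (Fin (m - n)) (Fin (m - n)) F))
      map_one' := by rw [Matrix.fromBlocks_one, map_one]
      map_mul' := fun A B => by rw [← map_mul, Matrix.fromBlocks_multiply]; simp }

variable {V : Type*} [AddCommGroup V] [Module ℂ V]

/-- `π` has asymptotic rank at most `k`: for all sufficiently large `m` there is a (finite
dimensional) representation `ρ` of `GL m` of low `U`-rank, with `U`-rank at most `k`, such that `π`
is contained in the restriction of `ρ` to `GL n`. -/
def AsymptoticRankLE (χ₀ : AddChar F ℂ) (π : Representation ℂ (GL (Fin n) F) V) (k : ℕ) : Prop :=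
  ∃ M : ℕ, ∀ m ≥ M, ∃ h : n ≤ m, ∃ (W : Type) (_ : AddCommGroup W) (_ : Module ℂ W)
    (_ : FiniteDimensional ℂ W) (ρ : Representation ℂ (GL (Fin m) F) W),
    IsLowURank χ₀ ρ ∧ uRank χ₀ ρ ≤ k ∧ IsContained π (ρ.comp (blockEmb F h))

/-- The asymptotic rank of `π`: the least `k` such that `π` has asymptotic rank at most `k`
(`⊤` if there is none). -/
noncomputable def asymptoticRank (χ₀ : AddChar F ℂ) (π : Representation ℂ (GL (Fin n) F) V) : ℕ∞ :=
  ⨅ (k : ℕ) (_ : AsymptoticRankLE χ₀ π k), (k : ℕ∞)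

end AsymptoticRank

section TensorRank

/-- The permutation representation of `GL n` on the space `L²(Fⁿ)` of complex functions on `Fⁿ`,
`(g f)(y) = f (g⁻¹ y)`. Up to equivalence and twist, this is the restriction to `GL n` of the
oscillator representation for the dual pair `(GL n, GL 1)`. -/
def permRep (F : Type*) [Field F] (n : ℕ) :
    Representation ℂ (GL (Fin n) F) ((Fin n → F) → ℂ) where
  toFun g := LinearMap.funLeft ℂ ℂ fun y => (g⁻¹ : GL (Fin n) F).val *ᵥ y
  map_one' := by ext f y; simp [LinearMap.funLeft]
  map_mul' g h := by
    refine LinearMap.ext fun f => funext fun y => ?_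
    simp only [LinearMap.funLeft_apply, Module.End.mul_apply, _root_.mul_inv_rev, Units.val_mul,
      Matrix.mulVec_mulVec]

variable {F : Type*} [Field F] {n : ℕ} {V : Type*} [AddCommGroup V] [Module ℂ V]

/-- The irreducible representation `ν` of `GL n` has tensor rank at most `k`: for some `ℓ ≤ k` it
is a component of a twist, by a character of `GL n`, of an `ℓ`-fold tensor product of irreducible
components of `L²(Fⁿ)`. -/
def IrrTensorRankLE (ν : Representation ℂ (GL (Fin n) F) V) (k : ℕ) : Prop :=
  ∃ ℓ ≤ k, ∃ (χ : GL (Fin n) F →* ℂˣ) (τ : Fin ℓ → Subrepresentation (permRep F n)),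
    (∀ i, (τ i).toRepresentation.IsIrreducible) ∧
      IsContained ν (twist χ (tensorProd fun i => (τ i).toRepresentation))

/-- A representation `π` has tensor rank at most `k` if all its irreducible components have:
its class lies in the span, in the representation ring, of the irreducible representations of
tensor rank at most `k`. -/
def TensorRankLE (π : Representation ℂ (GL (Fin n) F) V) (k : ℕ) : Prop :=
  ∀ ν : Subrepresentation π, ν.toRepresentation.IsIrreducible →
    IrrTensorRankLE ν.toRepresentation k

/-- The tensor rank of `π`: the least `k` such that `π` has tensor rank at most `k`
(`⊤` if there is none). -/
noncomputable def tensorRank (π : Representation ℂ (GL (Fin n) F) V) : ℕ∞ :=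
  ⨅ (k : ℕ) (_ : TensorRankLE π k), (k : ℕ∞)

end TensorRank

end GLRank

/-!
For every `k`, asymptotic rank at most `k` and tensor rank at most `k` are the same condition
(`tensorRankLE_of_asymptoticRankLE`, `asymptoticRankLE_of_tensorRankLE`).

*From tensor rank to asymptotic rank.* A tensor product of `k` copies of `L²(F^n)` is the space of
functions of `k` vectors in `F^n` (`tensorEquivFun`), and characters of `GL n` factor through the
determinant unless `n = q = 2` (`exists_char_eq_det`). So the components of a representation of
tensor rank at most `k` embed in spaces of functions of `k` vectors, twisted by characters of the
determinant. Such functions extend to functions of `k` vectors in `F^m`, depending only on the first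
`n` coordinates, and the twisted function spaces for `GL m` have `U`-rank at most `k`: the value at
`y` of an eigenfunction for a character `T` of `U` is fixed by the elements of `U` fixing `y`, so `T`
is trivial on them, and its rank is at most that of the coordinates of `y` in question
(`rank_le_of_charAppears`).

*From asymptotic rank to tensor rank.* Let `ρ` be a representation of `GL m` of `U`-rank at most `k`
with `m` large, and `w ≠ 0` a vector of it. The main result is `detected`: there are `k` vectors in
`F^n` and a linear functional `l` with `l w ≠ 0` that is invariant under the elements of `SL n` fixing
these vectors. By Frobenius reciprocity (`exists_permFun_of_functional`) some intertwining map from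
`ρ` restricted to `GL n` to a twisted space of functions of `k` vectors does not annihilate `w`; if
`w` is in an irreducible subrepresentation `ν` of the restriction, then `ν` embeds in the latter
space, and complete reducibility of `L²(F^n)` gives the tensor rank (`irrTensorRankLE_of_permFun`).

For the proof of `detected`, let `κ` be the block of the `m - n` remaining coordinates.
* If a root group in `κ` acts on `w` nontrivially, a nontrivial character of it occurs in `w`. The
  space of vectors transforming by this character under the root group and fixed by the rest of its
  row is a representation of a smaller general linear group, of rank at most `k - 1`, since a
  nondegenerate character occurring there can be enlarged by the one of the root group
  (`Corner.rankBound`). Induction applies.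
* Otherwise `w` is fixed by the special linear group of `κ`. Successive isotypic projections for the
  unipotent groups that join `F^n` to disjoint parts of `κ` lead to a vector that transforms by a
  matrix `S` of column vectors and a matrix `T` of row vectors (`Config`). If `rank S + rank T` is
  maximal, further such groups fix the vector as far as `S` and `T` permit, and by Whitehead's
  identity they generate the stabilizer of `(S, T)` in `SL n` (`Config.fix_stabilizer`). The rank
  bound gives `rank S + rank T ≤ k` (`Config.rank_add_rank_le`), and a Fourier transform turns the
  row vectors in `T` into column vectors (`Config.detected`).

To have induction and conjugation available without bookkeeping of indices, unipotent groups are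
written as `{1 + A X B}` for rectangular matrices with `B * A = 0`, and the bound on the `U`-rank is
used in the form `RankBound` for all such groups; `rankBound_of_uRank_le` derives it from the
standard subgroups.
-/

namespace GLRank

/-! ### Coordinate blocks, Whitehead's identity and generation of the special linear group -/

section Inclusion

variable {F : Type*} [Field F] {ι a b : Type*} [DecidableEq ι]

/-- The `0/1` matrix of a map `f : a → ι` of index types: its `j`-th column is the standard basis
vector `e_{f j}`. For injective `f` it embeds `F^a` into `F^ι` as a coordinate subspace. -/
def inc (F : Type*) [Field F] (f : a → ι) : Matrix ι a F := (1 : Matrix ι ι F).submatrix id f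

theorem inc_transpose_mul [Fintype ι] (f : a → ι) (g : b → ι) :
    (inc F f)ᵀ * inc F g = (1 : Matrix ι ι F).submatrix f g := by
  rw [inc, inc, transpose_submatrix, transpose_one,
    ← submatrix_mul 1 1 f id g Function.bijective_id, one_mul]

theorem inc_transpose_mul_self [Fintype ι] [DecidableEq a] {f : a → ι}
    (hf : Function.Injective f) : (inc F f)ᵀ * inc F f = 1 := by
  rw [inc_transpose_mul, submatrix_one f hf]

theorem inc_transpose_mul_of_disjoint [Fintype ι] {f : a → ι} {g : b → ι}
    (h : ∀ i j, f i ≠ g j) : (inc F f)ᵀ * inc F g = 0 := by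
  rw [inc_transpose_mul]
  ext i j
  simp [one_apply_ne (h i j)]

theorem inc_elim (f : a → ι) (g : b → ι) :
    inc F (Sum.elim f g) = fromCols (inc F f) (inc F g) := by
  ext i (j | j) <;> rfl

end Inclusion

section Whitehead

/-- Rewriting with `A * B = C` inside a product associated to the right. -/
theorem mul_mul_of_mul_eq {R l m n p : Type*} [NonUnitalSemiring R] [Fintype m] [Fintype n]
    {A : Matrix l m R} {B : Matrix m n R} {C : Matrix l n R} (h : A * B = C) (M : Matrix n p R) :
    A * (B * M) = C * M := by
  rw [← Matrix.mul_assoc, h]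

variable {F : Type*} [Field F] {ι α δ : Type*} [Fintype ι] [Fintype α] [Fintype δ]
  [DecidableEq ι] [DecidableEq α] [DecidableEq δ]

/-- Whitehead's identity: for complementary blocks `α`, `δ` inside `ι` and `g = 1 + e x`, the block
diagonal matrix with blocks `g` and `1 - x g⁻¹ e = (1 + x e)⁻¹` is a product of four elementary
block matrices. -/
theorem whitehead {a : Matrix ι α F} {a' : Matrix α ι F} {d : Matrix ι δ F} {d' : Matrix δ ι F}
    (haa : a' * a = 1) (hdd : d' * d = 1) (had : a' * d = 0) (hda : d' * a = 0)
    (e : Matrix α δ F) (x : Matrix δ α F) {g gi : Matrix α α F} (hg : g = 1 + e * x)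
    (h1 : g * gi = 1) (h2 : gi * g = 1) :
    (1 + d * (-(x * gi)) * a') * (1 + a * e * d') * (1 + d * x * a') * (1 + a * (-(gi * e)) * d') =
      (1 + a * (g - 1) * a') * (1 + d * ((1 - x * gi * e) - 1) * d') := by
  have he : e * x = g - 1 := by rw [hg]; abel
  simp only [Matrix.mul_add, Matrix.add_mul, Matrix.mul_sub, Matrix.sub_mul, Matrix.mul_assoc,
    Matrix.one_mul, Matrix.mul_one, Matrix.neg_mul, Matrix.mul_neg, mul_mul_of_mul_eq haa,
    mul_mul_of_mul_eq hdd, mul_mul_of_mul_eq had, mul_mul_of_mul_eq hda, mul_mul_of_mul_eq he,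
    mul_mul_of_mul_eq h1, mul_mul_of_mul_eq h2, Matrix.mul_zero, Matrix.zero_mul]
  abel

end Whitehead

section SpecialLinear

variable {F : Type*} [Field F] {κ : Type*} [Fintype κ] [DecidableEq κ]

/-- Whitehead's identity for blocks of size one: `diag(t, t⁻¹)` is a product of transvections. -/
theorem diagonal_pair_mem_closure {i j : κ} (hij : i ≠ j) {t : F} (ht : t ≠ 0) :
    diagonal (Function.update (Function.update 1 i t) j t⁻¹) ∈
      Submonoid.closure {M : Matrix κ κ F | ∃ i j c, i ≠ j ∧ M = transvection i j c} := by
  set K := Submonoid.closure {M : Matrix κ κ F | ∃ i j c, i ≠ j ∧ M = transvection i j c}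
  have hK (i j : κ) (h : i ≠ j) (c : Matrix Unit Unit F) :
      1 + inc F (fun _ : Unit => i) * c * (inc F fun _ : Unit => j)ᵀ ∈ K := by
    refine Submonoid.subset_closure ⟨i, j, c () (), h, ?_⟩
    ext p q
    simp [inc, transvection, mul_apply, single_apply, one_apply]
    grind
  have hw := whitehead (F := F) (inc_transpose_mul_self (f := fun _ : Unit => i)
    fun _ _ _ => rfl) (inc_transpose_mul_self (f := fun _ : Unit => j) fun _ _ _ => rfl)
    (inc_transpose_mul_of_disjoint fun _ _ => hij)
    (inc_transpose_mul_of_disjoint fun _ _ => hij.symm) 1 (of fun _ _ => t - 1)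
    (g := of fun _ _ => t) (gi := of fun _ _ => t⁻¹) (by ext; simp)
    (by ext; simp [mul_apply, ht]) (by ext; simp [mul_apply, ht])
  have hd : diagonal (Function.update (Function.update 1 i t) j t⁻¹) =
      (1 + inc F (fun _ : Unit => i) * ((of fun _ _ => t) - 1 : Matrix Unit Unit F) *
        (inc F fun _ : Unit => i)ᵀ) *
      (1 + inc F (fun _ : Unit => j) * ((1 - (of fun _ _ => t - 1) * (of fun _ _ => t⁻¹) * 1) - 1 :
        Matrix Unit Unit F) * (inc F fun _ : Unit => j)ᵀ) := by
    have h (i : κ) (c : Matrix Unit Unit F) : 1 + inc F (fun _ : Unit => i) * c *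
        (inc F fun _ : Unit => i)ᵀ = diagonal (Function.update 1 i (1 + c () ())) := by
      ext p q
      simp [inc, mul_apply, one_apply, diagonal_apply, Function.update_apply]
      grind
    rw [h, h, diagonal_mul_diagonal]
    congr 1
    funext p
    simp [Function.update_apply, mul_apply]
    have : 1 - (t - 1) * t⁻¹ = t⁻¹ := by field_simp; ring
    grind
  rw [hd, ← hw]
  exact K.mul_mem (K.mul_mem (K.mul_mem (hK _ _ hij.symm _) (hK _ _ hij _)) (hK _ _ hij.symm _))
    (hK _ _ hij _)

/-- A matrix of determinant one over a field is a product of transvections. -/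
theorem mem_closure_transvection {M : Matrix κ κ F} (hM : M.det = 1) :
    M ∈ Submonoid.closure {M : Matrix κ κ F | ∃ i j c, i ≠ j ∧ M = transvection i j c} := by
  set K := Submonoid.closure {M : Matrix κ κ F | ∃ i j c, i ≠ j ∧ M = transvection i j c}
  have hL (L : List (TransvectionStruct κ F)) :
      (L.map TransvectionStruct.toMatrix).prod ∈ K := by
    refine K.list_prod_mem fun x hx => ?_
    obtain ⟨t, -, rfl⟩ := List.mem_map.1 hx
    exact Submonoid.subset_closure ⟨t.i, t.j, t.c, t.hij, rfl⟩
  obtain ⟨L, L', D, rfl⟩ := Pivot.exists_list_transvec_mul_diagonal_mul_list_transvec M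
  refine K.mul_mem (K.mul_mem (hL L) ?_) (hL L')
  rw [det_mul, det_mul, TransvectionStruct.det_toMatrix_prod, TransvectionStruct.det_toMatrix_prod,
    one_mul, mul_one, det_diagonal] at hM
  have hD (i) : D i ≠ 0 := fun h => by
    rw [Finset.prod_eq_zero (Finset.mem_univ i) h] at hM
    exact zero_ne_one hM
  rcases isEmpty_or_nonempty κ with hκ | ⟨⟨i₀⟩⟩
  · rw [show diagonal D = 1 from Subsingleton.elim _ _]
    exact K.one_mem
  -- Clear the diagonal entries other than the one at `i₀`, one at a time.
  have key (s : Finset κ) (hs : i₀ ∉ s) :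
      diagonal (fun i => if i = i₀ then (∏ j ∈ s, D j)⁻¹ else if i ∈ s then D i else 1) ∈ K := by
    induction s using Finset.induction_on with
    | empty =>
      convert K.one_mem
      rw [← diagonal_one]
      congr 1
      funext i
      simp
    | insert j s hj ih =>
      have hne : j ≠ i₀ := fun h => hs (h ▸ Finset.mem_insert_self _ _)
      have := K.mul_mem (ih fun h => hs (Finset.mem_insert_of_mem h))
        (diagonal_pair_mem_closure hne (hD j))
      rw [diagonal_mul_diagonal] at this
      convert this using 2
      funext i
      simp only [Finset.mem_insert, Finset.prod_insert hj, Function.update_apply]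
      split_ifs <;> simp_all [mul_comm]
  convert key (Finset.univ.erase i₀) (Finset.notMem_erase _ _) using 2
  funext i
  split_ifs with h1 h2
  · rw [h1]
    refine eq_inv_of_mul_eq_one_left ?_
    rw [Finset.mul_prod_erase _ _ (Finset.mem_univ _), hM]
  · rfl
  · exact absurd (Finset.mem_erase.2 ⟨h1, Finset.mem_univ _⟩) h2

end SpecialLinear

/-! ### Unipotent groups, their isotypic projections and the rank bound -/

section TraceCharacters

variable {F : Type*} [Field F] {χ₀ : AddChar F ℂ} {a b : Type*} [Fintype a] [Fintype b]

theorem exists_trace_ne_one (hχ₀ : χ₀ ≠ 1) {X : Matrix a b F} (hX : X ≠ 0) :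
    ∃ T : Matrix b a F, χ₀ (T * X).trace ≠ 1 := by
  classical
  obtain ⟨i, j, hij⟩ : ∃ i j, X i j ≠ 0 := by
    by_contra! h
    exact hX (ext h)
  obtain ⟨x, hx⟩ := (AddChar.ne_one_iff).1 hχ₀
  refine ⟨single j i (x / X i j), ?_⟩
  rwa [trace_single_mul, smul_eq_mul, div_mul_cancel₀ _ hij]

/-- Orthogonality of the characters `T ↦ χ₀ (trace (T X))` of a space of matrices. -/
theorem sum_trace_char [Fintype F] [DecidableEq F] [DecidableEq a] [DecidableEq b] (hχ₀ : χ₀ ≠ 1)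
    (X : Matrix a b F) :
    ∑ T : Matrix b a F, χ₀ (T * X).trace =
      if X = 0 then (Fintype.card (Matrix b a F) : ℂ) else 0 := by
  split_ifs with h
  · simp [h]
  · obtain ⟨T₀, hT₀⟩ := exists_trace_ne_one hχ₀ h
    refine eq_zero_of_mul_eq_self_left hT₀ ?_
    rw [Finset.mul_sum]
    refine Fintype.sum_equiv (Equiv.addLeft T₀) _ _ fun T => ?_
    simp [Matrix.add_mul, AddChar.map_add_eq_mul]

end TraceCharacters

section UnipotentGroups

variable {F : Type*} [Field F] {ι a b : Type*} [Fintype ι] [Fintype a] [Fintype b]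
  [DecidableEq ι]

theorem unip_mul_unip {c d : Type*} [Fintype c] [Fintype d] {A : Matrix ι a F} {B : Matrix b ι F}
    {C : Matrix ι c F} {D : Matrix d ι F} (h : B * C = 0) (X : Matrix a b F) (Y : Matrix c d F) :
    (1 + A * X * B) * (1 + C * Y * D) = 1 + (A * X * B + C * Y * D) := by
  simp only [Matrix.mul_add, Matrix.add_mul, Matrix.mul_assoc, mul_mul_of_mul_eq h, Matrix.one_mul,
    Matrix.mul_one, Matrix.zero_mul, Matrix.mul_zero]
  abel

theorem unip_add {A : Matrix ι a F} {B : Matrix b ι F} (h : B * A = 0) (X Y : Matrix a b F) :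
    (1 + A * X * B) * (1 + A * Y * B) = 1 + A * (X + Y) * B := by
  rw [unip_mul_unip h, Matrix.mul_add, Matrix.add_mul]

theorem unip_commute {c d : Type*} [Fintype c] [Fintype d] {A : Matrix ι a F} {B : Matrix b ι F}
    {C : Matrix ι c F} {D : Matrix d ι F} (h : B * C = 0) (h' : D * A = 0) (X : Matrix a b F)
    (Y : Matrix c d F) : Commute (1 + A * X * B) (1 + C * Y * D) := by
  rw [Commute, SemiconjBy, unip_mul_unip h, unip_mul_unip h', add_comm (A * X * B)]

/-- The embedding of square matrices of size `a` into those of size `ι` that acts as `g` on the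
image of `A` and as the identity on the kernel of `A'`; here `A' * A = 1`. -/
def emb (A : Matrix ι a F) (A' : Matrix a ι F) [DecidableEq a] (g : Matrix a a F) : Matrix ι ι F :=
  1 + A * (g - 1) * A'

variable [DecidableEq a] {A : Matrix ι a F} {A' : Matrix a ι F}

theorem emb_mul (h : A' * A = 1) (g g' : Matrix a a F) :
    emb A A' (g * g') = emb A A' g * emb A A' g' := by
  simp only [emb, Matrix.mul_add, Matrix.add_mul, Matrix.mul_sub, Matrix.sub_mul, Matrix.mul_assoc,
    mul_mul_of_mul_eq h, Matrix.one_mul, Matrix.mul_one]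
  abel

theorem emb_mul_self (h : A' * A = 1) (g : Matrix a a F) : emb A A' g * A = A * g := by
  simp [emb, Matrix.add_mul, Matrix.mul_assoc, h, Matrix.mul_sub]

theorem self_mul_emb (h : A' * A = 1) (g : Matrix a a F) : A' * emb A A' g = g * A' := by
  simp [emb, Matrix.mul_add, Matrix.mul_assoc, mul_mul_of_mul_eq h, Matrix.sub_mul]

theorem emb_mul_of_eq_zero {c : Type*} {C : Matrix ι c F} (h : A' * C = 0) (g : Matrix a a F) :
    emb A A' g * C = C := by
  simp [emb, Matrix.add_mul, Matrix.mul_assoc, h]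

theorem mul_emb_of_eq_zero {c : Type*} {C : Matrix c ι F} (h : C * A = 0) (g : Matrix a a F) :
    C * emb A A' g = C := by
  simp [emb, Matrix.mul_add, ← Matrix.mul_assoc, h]

/-- Conjugation of a unipotent block by an element of a smaller general linear group. -/
theorem emb_mul_unip {c d : Type*} [Fintype c] [Fintype d] {C C' : Matrix ι c F}
    {D D' : Matrix d ι F} {g : Matrix a a F} (hC : emb A A' g * C = C')
    (hD : D' * emb A A' g = D) (X : Matrix c d F) :
    emb A A' g * (1 + C * X * D) = (1 + C' * X * D') * emb A A' g := by
  rw [Matrix.mul_add, Matrix.add_mul, ← hC, ← hD]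
  simp only [Matrix.mul_assoc, Matrix.one_mul, Matrix.mul_one]

end UnipotentGroups

section Isotypic

variable {F : Type*} [Field F] {ι a b : Type*} [Fintype ι] [DecidableEq ι] [Fintype a] [Fintype b]
  {V : Type*} [AddCommGroup V] [Module ℂ V]

/-- The vector `v` transforms under the group of all `1 + A X B` (with `B * A = 0`) by the
character `X ↦ χ₀ (trace (T X))`. Representations of general linear groups enter as
multiplicative maps `R` on all matrices, the singular ones acting by zero. -/
def ActsBy (χ₀ : AddChar F ℂ) (R : Matrix ι ι F →* Module.End ℂ V) (A : Matrix ι a F)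
    (B : Matrix b ι F) (T : Matrix b a F) (v : V) : Prop :=
  ∀ X : Matrix a b F, R (1 + A * X * B) v = χ₀ (T * X).trace • v

/-- The (unnormalized) projection to the vectors on which the group of all `1 + A X B` acts by the
character `X ↦ χ₀ (trace (T X))`. -/
noncomputable def proj [Fintype F] [DecidableEq a] [DecidableEq b] (χ₀ : AddChar F ℂ)
    (R : Matrix ι ι F →* Module.End ℂ V)
    (A : Matrix ι a F) (B : Matrix b ι F) (T : Matrix b a F) : Module.End ℂ V :=
  ∑ X : Matrix a b F, χ₀ (-(T * X).trace) • R (1 + A * X * B)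

variable {χ₀ : AddChar F ℂ} {R : Matrix ι ι F →* Module.End ℂ V}
  {A : Matrix ι a F} {B : Matrix b ι F}

theorem map_mul_apply (M N : Matrix ι ι F) (v : V) : R (M * N) v = R M (R N v) := by
  rw [map_mul]; rfl

theorem actsBy_zero_iff {v : V} :
    ActsBy χ₀ R A B 0 v ↔ ∀ X : Matrix a b F, R (1 + A * X * B) v = v := by
  simp [ActsBy]

section Proj

variable [Fintype F] [DecidableEq a] [DecidableEq b]

theorem proj_apply (T : Matrix b a F) (v : V) :
    proj χ₀ R A B T v = ∑ X : Matrix a b F, χ₀ (-(T * X).trace) • R (1 + A * X * B) v := by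
  simp [proj]

theorem actsBy_proj (h : B * A = 0) (T : Matrix b a F) (v : V) :
    ActsBy χ₀ R A B T (proj χ₀ R A B T v) := by
  intro Y
  rw [proj_apply, map_sum, Finset.smul_sum]
  refine Fintype.sum_equiv (Equiv.addLeft Y) _ _ fun X => ?_
  rw [map_smul, ← map_mul_apply, unip_add h, smul_smul, ← AddChar.map_add_eq_mul]
  congr 2
  simp [Matrix.mul_add]

theorem sum_proj (hχ₀ : χ₀ ≠ 1) (v : V) :
    ∑ T, proj χ₀ R A B T v = (Fintype.card (Matrix b a F) : ℂ) • v := by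
  classical
  simp_rw [proj_apply]
  rw [Finset.sum_comm]
  simp_rw [← Finset.sum_smul, ← Matrix.trace_neg, ← Matrix.mul_neg, sum_trace_char hχ₀]
  rw [Finset.sum_eq_single 0]
  · simp
  · intro X _ hX
    simp [hX]
  · simp

theorem exists_proj_ne_zero (hχ₀ : χ₀ ≠ 1) {v : V} (hv : v ≠ 0) (A : Matrix ι a F)
    (B : Matrix b ι F) : ∃ T, proj χ₀ R A B T v ≠ 0 := by
  by_contra! h
  have := sum_proj (R := R) (A := A) (B := B) hχ₀ v
  simp only [h, Finset.sum_const_zero] at this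
  rcases smul_eq_zero.1 this.symm with h | h
  · simp at h
  · exact hv h

/-- If `1 + A Y B` acts trivially on all nonzero isotypic components of `v`, it fixes `v`. -/
theorem fixed_of_proj (hχ₀ : χ₀ ≠ 1) (h : B * A = 0) {v : V} {Y : Matrix a b F}
    (hY : ∀ T, proj χ₀ R A B T v ≠ 0 → χ₀ (T * Y).trace = 1) : R (1 + A * Y * B) v = v := by
  have hs := sum_proj (R := R) (A := A) (B := B) hχ₀ v
  have hc : (Fintype.card (Matrix b a F) : ℂ) ≠ 0 := by simp
  rw [← smul_right_injective V hc |>.eq_iff]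
  change (_ : ℂ) • R _ v = (_ : ℂ) • v
  rw [← map_smul, ← hs, map_sum]
  refine Finset.sum_congr rfl fun T _ => ?_
  rw [actsBy_proj h]
  by_cases hT : proj χ₀ R A B T v = 0
  · rw [hT, smul_zero]
  · rw [hY T hT, one_smul]

theorem map_proj_of_commute {M : Matrix ι ι F} {v : V} (T : Matrix b a F)
    (h : ∀ X : Matrix a b F, R M (R (1 + A * X * B) v) = R (1 + A * X * B) (R M v)) :
    R M (proj χ₀ R A B T v) = proj χ₀ R A B T (R M v) := by
  simp_rw [proj_apply, map_sum, map_smul, h]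

theorem map_proj_of_commute' {M : Matrix ι ι F} (v : V) (T : Matrix b a F)
    (h : ∀ X : Matrix a b F, Commute M (1 + A * X * B)) :
    R M (proj χ₀ R A B T v) = proj χ₀ R A B T (R M v) :=
  map_proj_of_commute T fun X => by rw [← map_mul_apply, (h X).eq, map_mul_apply]

/-- Commuting unipotent groups preserve each other's isotypic components. -/
theorem ActsBy.proj {c d : Type*} [Fintype c] [Fintype d] {C : Matrix ι c F} {D : Matrix d ι F}
    {S : Matrix d c F} {v : V} (hv : ActsBy χ₀ R C D S v) (h : B * C = 0) (h' : D * A = 0)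
    (T : Matrix b a F) : ActsBy χ₀ R C D S (proj χ₀ R A B T v) := by
  intro X
  rw [map_proj_of_commute' v T fun Y => (unip_commute h' h X Y), hv X, map_smul]

/-- Equivariance of the isotypic projections under conjugation by `g`, when the character is
transported accordingly. -/
theorem proj_map {M : Matrix ι ι F} (T : Matrix b a F) (p : Matrix a b F ≃ Matrix a b F)
    (hp : ∀ X, M * (1 + A * X * B) = (1 + A * p X * B) * M)
    (hT : ∀ X, (T * p X).trace = (T * X).trace) (v : V) :
    GLRank.proj χ₀ R A B T (R M v) = R M (GLRank.proj χ₀ R A B T v) := by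
  rw [proj_apply, proj_apply, map_sum]
  refine (Fintype.sum_equiv p _ _ fun X => ?_).symm
  rw [map_smul, ← map_mul_apply, hp, map_mul_apply, hT]

end Proj

/-- Characters on the four blocks of a unipotent group combine to one of the whole group. -/
theorem ActsBy.block {a₁ a₂ b₁ b₂ : Type*} [Fintype a₁] [Fintype a₂] [Fintype b₁] [Fintype b₂]
    {A₁ : Matrix ι a₁ F} {A₂ : Matrix ι a₂ F} {B₁ : Matrix b₁ ι F} {B₂ : Matrix b₂ ι F}
    {T₁₁ : Matrix b₁ a₁ F} {T₁₂ : Matrix b₁ a₂ F} {T₂₁ : Matrix b₂ a₁ F} {T₂₂ : Matrix b₂ a₂ F}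
    {v : V} (h₁₁ : ActsBy χ₀ R A₁ B₁ T₁₁ v) (h₁₂ : ActsBy χ₀ R A₂ B₁ T₁₂ v)
    (h₂₁ : ActsBy χ₀ R A₁ B₂ T₂₁ v) (h₂₂ : ActsBy χ₀ R A₂ B₂ T₂₂ v)
    (h : fromRows B₁ B₂ * fromCols A₁ A₂ = 0) :
    ActsBy χ₀ R (fromCols A₁ A₂) (fromRows B₁ B₂) (fromBlocks T₁₁ T₁₂ T₂₁ T₂₂) v := by
  intro X
  obtain ⟨X₁₁, X₁₂, X₂₁, X₂₂, rfl⟩ : ∃ X₁₁ X₁₂ X₂₁ X₂₂, X = fromBlocks X₁₁ X₁₂ X₂₁ X₂₂ :=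
    ⟨_, _, _, _, (fromBlocks_toBlocks X).symm⟩
  rw [fromRows_mul_fromCols, ← fromBlocks_zero, fromBlocks_inj] at h
  obtain ⟨e₁₁, e₁₂, e₂₁, e₂₂⟩ := h
  have : 1 + fromCols A₁ A₂ * fromBlocks X₁₁ X₁₂ X₂₁ X₂₂ * fromRows B₁ B₂ =
      (1 + A₁ * X₁₁ * B₁) * ((1 + A₁ * X₁₂ * B₂) * ((1 + A₂ * X₂₁ * B₁) *
        (1 + A₂ * X₂₂ * B₂))) := by
    simp only [fromCols_mul_fromBlocks, fromCols_mul_fromRows, Matrix.mul_add, Matrix.add_mul,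
      Matrix.mul_assoc, mul_mul_of_mul_eq e₁₁, mul_mul_of_mul_eq e₁₂,
      mul_mul_of_mul_eq e₂₂, Matrix.one_mul, Matrix.mul_one, Matrix.zero_mul, Matrix.mul_zero]
    abel
  rw [this, map_mul_apply, map_mul_apply, map_mul_apply, h₂₂, map_smul, h₁₂, map_smul, map_smul,
    map_smul, h₂₁, map_smul, map_smul, h₁₁]
  simp only [smul_smul, ← AddChar.map_add_eq_mul, fromBlocks_multiply]
  congr 2
  simp only [trace, diag_apply, Fintype.sum_sum_type, fromBlocks_apply₁₁, fromBlocks_apply₂₂,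
    Matrix.add_apply, Finset.sum_add_distrib]
  abel

end Isotypic

section RankBound

variable {F : Type*} [Field F] {ι : Type*} [Fintype ι] [DecidableEq ι]
  {V : Type*} [AddCommGroup V] [Module ℂ V]

/-- A coordinate-free form of the condition that the `U`-rank is at most `k`: nondegenerate
characters occur only in groups `{1 + A X B}` of square blocks `X` of size at most `k`, where the
columns of `A` and the rows of `B` are linearly independent and `B * A = 0`. -/
def RankBound (χ₀ : AddChar F ℂ) (R : Matrix ι ι F →* Module.End ℂ V) (k : ℕ) : Prop :=
  ∀ (τ : Type) [Fintype τ] [DecidableEq τ] (A : Matrix ι τ F) (A' : Matrix τ ι F)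
    (B : Matrix τ ι F) (B' : Matrix ι τ F) (T : Matrix τ τ F) (v : V), B * A = 0 → A' * A = 1 →
    B * B' = 1 → IsUnit T.det → v ≠ 0 → ActsBy χ₀ R A B T v → Fintype.card τ ≤ k

/-- Two blocks with nondegenerate characters can be joined to one if the character is trivial on
one of the two mixed blocks: whatever happens on the other mixed block, the character obtained is
block triangular, hence nondegenerate. -/
theorem RankBound.block [Fintype F] {χ₀ : AddChar F ℂ} (hχ₀ : χ₀ ≠ 1)
    {R : Matrix ι ι F →* Module.End ℂ V} {k : ℕ} (hR : RankBound χ₀ R k) {τ₁ τ₂ : Type}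
    [Fintype τ₁] [Fintype τ₂] [DecidableEq τ₁] [DecidableEq τ₂]
    {A₁ : Matrix ι τ₁ F} {A₂ : Matrix ι τ₂ F} {A' : Matrix (τ₁ ⊕ τ₂) ι F}
    {B₁ : Matrix τ₁ ι F} {B₂ : Matrix τ₂ ι F} {B' : Matrix ι (τ₁ ⊕ τ₂) F}
    {T₁ : Matrix τ₁ τ₁ F} {T₂ : Matrix τ₂ τ₂ F} {v : V} (hv : v ≠ 0)
    (h : fromRows B₁ B₂ * fromCols A₁ A₂ = 0) (hA : A' * fromCols A₁ A₂ = 1)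
    (hB : fromRows B₁ B₂ * B' = 1) (hT₁ : IsUnit T₁.det) (hT₂ : IsUnit T₂.det)
    (h₁ : ActsBy χ₀ R A₁ B₁ T₁ v) (h₂ : ActsBy χ₀ R A₂ B₂ T₂ v) (h₀ : ActsBy χ₀ R A₁ B₂ 0 v) :
    Fintype.card τ₁ + Fintype.card τ₂ ≤ k := by
  -- The character `T` on the other mixed block is arbitrary.
  obtain ⟨T, hT⟩ := exists_proj_ne_zero (R := R) hχ₀ hv A₂ B₁
  have h' := h
  rw [fromRows_mul_fromCols, ← fromBlocks_zero, fromBlocks_inj] at h'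
  obtain ⟨e₁₁, e₁₂, e₂₁, e₂₂⟩ := h'
  have := ActsBy.block (h₁.proj e₁₁ e₁₂ T) (actsBy_proj e₁₂ T v) (h₀.proj e₁₁ e₂₂ T)
    (h₂.proj e₁₂ e₂₂ T) h
  rw [← Fintype.card_sum]
  refine hR _ _ A' _ B' _ _ h hA hB ?_ hT this
  rw [det_fromBlocks_zero₂₁]
  exact hT₁.mul hT₂

end RankBound

/-! ### Ranks of matrices -/

section LinearAlgebra

variable {F : Type*} [Field F] {m n p q : Type*} [Fintype n]

/-- Rank factorization: a matrix of rank `r` is the product of a matrix with `r` independent columns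
and one with `r` independent rows. -/
theorem exists_rank_factorization [Fintype m] [DecidableEq m] [DecidableEq n] (M : Matrix m n F) :
    ∃ r, r = M.rank ∧ ∃ (C : Matrix m (Fin r) F) (D : Matrix (Fin r) n F) (C' : Matrix (Fin r) m F)
      (D' : Matrix n (Fin r) F), M = C * D ∧ C' * C = 1 ∧ D * D' = 1 := by
  let W := LinearMap.range M.mulVecLin
  let e : W ≃ₗ[F] (Fin M.rank → F) :=
    LinearEquiv.ofFinrankEq _ _ (Module.finrank_fin_fun F).symm
  let f : (Fin M.rank → F) →ₗ[F] (m → F) := W.subtype ∘ₗ e.symm.toLinearMap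
  let g : (n → F) →ₗ[F] (Fin M.rank → F) := e.toLinearMap ∘ₗ M.mulVecLin.rangeRestrict
  have hf : Function.Injective f := W.injective_subtype.comp e.symm.injective
  have hg : Function.Surjective g := e.surjective.comp M.mulVecLin.surjective_rangeRestrict
  obtain ⟨f', hf'⟩ := f.exists_leftInverse_of_injective (LinearMap.ker_eq_bot.2 hf)
  obtain ⟨g', hg'⟩ := g.exists_rightInverse_of_surjective (LinearMap.range_eq_top.2 hg)
  refine ⟨_, rfl, LinearMap.toMatrix' f, LinearMap.toMatrix' g, LinearMap.toMatrix' f',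
    LinearMap.toMatrix' g', ?_, ?_, ?_⟩
  · rw [← LinearMap.toMatrix'_comp]
    apply Matrix.toLin'.injective
    rw [Matrix.toLin'_toMatrix']
    refine LinearMap.ext fun v => ?_
    simp [f, g]
  · rw [← LinearMap.toMatrix'_comp, hf', LinearMap.toMatrix'_id]
  · rw [← LinearMap.toMatrix'_comp, hg', LinearMap.toMatrix'_id]

/-- Rows that do not increase the rank do not shrink the kernel. -/
theorem mul_eq_zero_of_rank_fromRows_le {T : Matrix m n F} {D : Matrix p n F}
    (h : (fromRows T D).rank ≤ T.rank) {Y : Matrix n q F} (hY : T * Y = 0) : D * Y = 0 := by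
  have hle : LinearMap.ker (fromRows T D).mulVecLin ≤ LinearMap.ker T.mulVecLin := by
    intro x hx
    simp only [LinearMap.mem_ker, mulVecLin_apply, fromRows_mulVec] at hx ⊢
    funext i
    exact congrFun hx (Sum.inl i)
  have heq : LinearMap.ker (fromRows T D).mulVecLin = LinearMap.ker T.mulVecLin := by
    refine Submodule.eq_of_le_of_finrank_le hle ?_
    have h1 := LinearMap.finrank_range_add_finrank_ker T.mulVecLin
    have h2 := LinearMap.finrank_range_add_finrank_ker (fromRows T D).mulVecLin
    rw [Matrix.rank, Matrix.rank] at h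
    omega
  ext i j
  have hj : Yᵀ j ∈ LinearMap.ker T.mulVecLin := by
    rw [LinearMap.mem_ker, mulVecLin_apply]
    funext i
    exact congrFun (congrFun hY i) j
  rw [← heq, LinearMap.mem_ker, mulVecLin_apply, fromRows_mulVec] at hj
  exact congrFun hj (Sum.inr i)

theorem mul_eq_zero_of_rank_fromCols_le [Fintype m] [Fintype p] {S : Matrix n m F} {D : Matrix n p F}
    (h : (fromCols S D).rank ≤ S.rank) {Y : Matrix q n F} (hY : Y * S = 0) : Y * D = 0 := by
  rw [← rank_transpose, ← rank_transpose S, transpose_fromCols] at h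
  rw [← transpose_eq_zero, transpose_mul] at hY ⊢
  exact mul_eq_zero_of_rank_fromRows_le h hY

end LinearAlgebra

/-! ### Configurations of isotypic projections -/

section Configurations

variable {F : Type*} [Field F] {ι α κ : Type} [Fintype ι] [Fintype α] [Fintype κ]
  [DecidableEq ι] [DecidableEq α] [DecidableEq κ] {V : Type*} [AddCommGroup V] [Module ℂ V]

/-- Two complementary coordinate blocks `α` and `κ` inside `ι`, given by the columns of `a`, `c` and
the dual rows of `a'`, `c'`. -/
structure Frame (a : Matrix ι α F) (a' : Matrix α ι F) (c : Matrix ι κ F) (c' : Matrix κ ι F) :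
    Prop where
  aa : a' * a = 1
  cc : c' * c = 1
  ac : a' * c = 0
  ca : c' * a = 0

/-- A vector `Q w` obtained from `w` by isotypic projections in two disjoint coordinate blocks
`ν₁`, `ν₂` of `κ`: it transforms by the character `S` under the unipotent group of rows `ν₁` and
columns `α`, and by `T` under that of rows `α` and columns `ν₂`. It is still fixed by the elements of
the special linear group of `κ` that fix the rows `ν₂` and the columns `ν₁`, and `Q` commutes with
the stabilizer of `(S, T)` in the special linear group of `α`. -/
structure Config (χ₀ : AddChar F ℂ) (R : Matrix ι ι F →* Module.End ℂ V) (a : Matrix ι α F)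
    (a' : Matrix α ι F) (c : Matrix ι κ F) (c' : Matrix κ ι F) (w : V) {ν₁ ν₂ : Type}
    [Fintype ν₁] [Fintype ν₂] (e₁ : ν₁ → κ) (e₂ : ν₂ → κ)
    (S : Matrix α ν₁ F) (T : Matrix ν₂ α F) (Q : Module.End ℂ V) : Prop where
  inj : Function.Injective (Sum.elim e₁ e₂)
  ne : Q w ≠ 0
  actS : ActsBy χ₀ R (c * inc F e₁) a' S (Q w)
  actT : ActsBy χ₀ R a ((inc F e₂)ᵀ * c') T (Q w)
  fix : ∀ h : Matrix κ κ F, h.det = 1 → (inc F e₂)ᵀ * h = (inc F e₂)ᵀ →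
    h * inc F e₁ = inc F e₁ → R (emb c c' h) (Q w) = Q w
  comm : ∀ g : Matrix α α F, g.det = 1 → g * S = S → T * g = T → ∀ u,
    Q (R (emb a a' g) u) = R (emb a a' g) (Q u)

variable {χ₀ : AddChar F ℂ} {R : Matrix ι ι F →* Module.End ℂ V} {a : Matrix ι α F}
    {a' : Matrix α ι F} {c : Matrix ι κ F} {c' : Matrix κ ι F} {w : V} {ν₁ ν₂ δ : Type}
    [Fintype ν₁] [Fintype ν₂] [Fintype δ] {e₁ : ν₁ → κ} {e₂ : ν₂ → κ}
    {S : Matrix α ν₁ F} {T : Matrix ν₂ α F} {Q : Module.End ℂ V}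

theorem det_one_add_inc {μ ν : Type} [Fintype μ] [Fintype ν] {e : μ → κ} {f : ν → κ}
    (h : ∀ i j, f j ≠ e i) (Z : Matrix μ ν F) :
    (1 + inc F e * Z * (inc F f)ᵀ : Matrix κ κ F).det = 1 := by
  classical
  rw [Matrix.mul_assoc, det_one_add_mul_comm, Matrix.mul_assoc,
    inc_transpose_mul_of_disjoint fun j i => h i j, Matrix.mul_zero, add_zero, det_one]

/-- The vector of a configuration is fixed by the unipotent block of rows `μ` and columns `ν`, for
disjoint coordinate blocks `μ` disjoint from `ν₂` and `ν` disjoint from `ν₁`. -/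
theorem Config.fix_unip (hC : Config χ₀ R a a' c c' w e₁ e₂ S T Q) {μ ν : Type} [Fintype μ]
    [Fintype ν] {e : μ → κ} {f : ν → κ} (h : ∀ i j, f j ≠ e i) (he : ∀ i j, e₂ j ≠ e i)
    (hf : ∀ i j, f j ≠ e₁ i) (Z : Matrix μ ν F) :
    R (1 + (c * inc F e) * Z * ((inc F f)ᵀ * c')) (Q w) = Q w := by
  have := hC.fix (1 + inc F e * Z * (inc F f)ᵀ) (det_one_add_inc h Z) ?_ ?_
  · rw [emb, add_sub_cancel_left] at this
    simpa only [Matrix.mul_assoc] using this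
  · rw [Matrix.mul_add, Matrix.mul_assoc, ← Matrix.mul_assoc _ (inc F e),
      inc_transpose_mul_of_disjoint fun j i => he i j]
    simp
  · rw [Matrix.add_mul, Matrix.mul_assoc, inc_transpose_mul_of_disjoint fun j i => hf i j]
    simp

variable [Fintype F]

/-- A further isotypic projection, for rows `α` and columns in a fresh block `d`, extends `T`. -/
theorem Config.extend_right [DecidableEq δ] (hF : Frame a a' c c')
    (hC : Config χ₀ R a a' c c' w e₁ e₂ S T Q)
    {d : δ → κ} (hd : Function.Injective (Sum.elim (Sum.elim e₁ e₂) d)) {D : Matrix δ α F}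
    (hD : proj χ₀ R a ((inc F d)ᵀ * c') D (Q w) ≠ 0) :
    Config χ₀ R a a' c c' w e₁ (Sum.elim e₂ d) S (fromRows T D)
      (proj χ₀ R a ((inc F d)ᵀ * c') D * Q) := by
  have hd1 (i j) : d j ≠ e₁ i := fun h => by
    simpa using @hd (.inr j) (.inl (.inl i)) h
  have h0 : (inc F d)ᵀ * c' * a = 0 := by rw [Matrix.mul_assoc, hF.ca, Matrix.mul_zero]
  refine ⟨?_, hD, ?_, ?_, ?_, ?_⟩
  · have : Sum.elim e₁ (Sum.elim e₂ d) =
        Sum.elim (Sum.elim e₁ e₂) d ∘ (Equiv.sumAssoc ν₁ ν₂ δ).symm := by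
      ext (_ | _ | _) <;> rfl
    rw [this]
    exact hd.comp (Equiv.injective _)
  · intro X
    change R _ (proj χ₀ R a ((inc F d)ᵀ * c') D (Q w)) = _ • (proj χ₀ R a ((inc F d)ᵀ * c') D (Q w))
    rw [← map_smul, ← hC.actS X]
    refine map_proj_of_commute D fun Y => ?_
    -- The commutator of the two blocks lies in a block fixing `Q w`.
    have h1 : (1 + c * inc F e₁ * X * a') * (1 + a * Y * ((inc F d)ᵀ * c')) =
        (1 + a * Y * ((inc F d)ᵀ * c')) * (1 + c * inc F e₁ * X * a') *
          (1 + (c * inc F e₁) * (X * Y) * ((inc F d)ᵀ * c')) := by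
      have h2 : (inc F d)ᵀ * inc F e₁ = 0 := inc_transpose_mul_of_disjoint fun j i => hd1 i j
      simp only [Matrix.mul_add, Matrix.add_mul, Matrix.mul_assoc, mul_mul_of_mul_eq hF.cc,
        mul_mul_of_mul_eq hF.aa, mul_mul_of_mul_eq hF.ac, mul_mul_of_mul_eq h2,
        Matrix.one_mul, Matrix.mul_one, Matrix.zero_mul, Matrix.mul_zero]
      abel
    rw [← map_mul_apply, h1, map_mul_apply, map_mul_apply]
    congr 2
    exact hC.fix_unip (fun i j => hd1 i j) (fun i j h => by
      simpa using @hC.inj (.inr j) (.inl i) h) (fun i j => hd1 i j) _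
  · intro X
    obtain ⟨X₁, X₂, rfl⟩ : ∃ X₁ X₂, X = fromCols X₁ X₂ := ⟨_, _, (fromCols_toCols X).symm⟩
    have h1 : 1 + a * fromCols X₁ X₂ * ((inc F (Sum.elim e₂ d))ᵀ * c') =
        (1 + a * X₁ * ((inc F e₂)ᵀ * c')) * (1 + a * X₂ * ((inc F d)ᵀ * c')) := by
      rw [unip_mul_unip (by rw [Matrix.mul_assoc, hF.ca, Matrix.mul_zero]), inc_elim,
        transpose_fromCols, fromRows_mul, mul_fromCols, fromCols_mul_fromRows]
    rw [h1, map_mul_apply, Module.End.mul_apply, actsBy_proj h0, map_smul,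
      hC.actT.proj h0 (by rw [Matrix.mul_assoc, hF.ca, Matrix.mul_zero]) D X₁, smul_smul,
      ← AddChar.map_add_eq_mul, fromRows_mul_fromCols]
    congr 2
    simp [trace, Fintype.sum_sum_type, add_comm]
  · intro h h1 h2 h3
    rw [inc_elim, transpose_fromCols, fromRows_mul, fromRows_ext_iff] at h2
    obtain ⟨h2, h4⟩ := h2
    rw [Module.End.mul_apply]
    nth_rw 2 [← hC.fix h h1 h2 h3]
    refine map_proj_of_commute' _ D fun Y => ?_
    refine emb_mul_unip (emb_mul_of_eq_zero hF.ca h) ?_ Y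
    rw [Matrix.mul_assoc, self_mul_emb hF.cc, ← Matrix.mul_assoc, h4]
  · intro g h1 h2 h3 u
    rw [fromRows_mul, fromRows_ext_iff] at h3
    obtain ⟨h3, h4⟩ := h3
    rw [Module.End.mul_apply, Module.End.mul_apply, hC.comm g h1 h2 h3]
    have hu : IsUnit g.det := by rw [h1]; exact isUnit_one
    refine proj_map D ⟨fun X => g * X, fun X => g⁻¹ * X, fun X => ?_, fun X => ?_⟩
      (fun X => ?_) (fun X => ?_) _
    · simp [nonsing_inv_mul_cancel_left _ _ hu]
    · simp [mul_nonsing_inv_cancel_left _ _ hu]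
    · simp only [Equiv.coe_fn_mk]
      rw [emb_mul_unip (emb_mul_self hF.aa g) (mul_emb_of_eq_zero h0 g), Matrix.mul_assoc a g]
    · simp only [Equiv.coe_fn_mk]
      rw [← Matrix.mul_assoc, h4]

/-- A further isotypic projection, for rows in a fresh block `d` and columns `α`, extends `S`. -/
theorem Config.extend_left [DecidableEq δ] (hF : Frame a a' c c')
    (hC : Config χ₀ R a a' c c' w e₁ e₂ S T Q)
    {d : δ → κ} (hd : Function.Injective (Sum.elim (Sum.elim e₁ e₂) d)) {D : Matrix α δ F}
    (hD : proj χ₀ R (c * inc F d) a' D (Q w) ≠ 0) :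
    Config χ₀ R a a' c c' w (Sum.elim e₁ d) e₂ (fromCols S D) T
      (proj χ₀ R (c * inc F d) a' D * Q) := by
  have hd2 (i j) : e₂ j ≠ d i := fun h => by
    simpa using @hd (.inl (.inr j)) (.inr i) h
  have h0 : a' * (c * inc F d) = 0 := by rw [← Matrix.mul_assoc, hF.ac, Matrix.zero_mul]
  refine ⟨?_, hD, ?_, ?_, ?_, ?_⟩
  · have h1 : Sum.elim (Sum.elim e₁ d) e₂ = Sum.elim (Sum.elim e₁ e₂) d ∘
        Sum.elim (Sum.elim (Sum.inl ∘ Sum.inl) Sum.inr) (Sum.inl ∘ Sum.inr) := by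
      ext ((_ | _) | _) <;> rfl
    rw [h1]
    refine hd.comp ?_
    rintro ((_ | _) | _) ((_ | _) | _) <;> simp
  · intro X
    obtain ⟨X₁, X₂, rfl⟩ : ∃ X₁ X₂, X = fromRows X₁ X₂ := ⟨_, _, (fromRows_toRows X).symm⟩
    have h1 : 1 + c * inc F (Sum.elim e₁ d) * fromRows X₁ X₂ * a' =
        (1 + c * inc F e₁ * X₁ * a') * (1 + c * inc F d * X₂ * a') := by
      rw [unip_mul_unip h0, inc_elim, mul_fromCols, fromCols_mul_fromRows, Matrix.add_mul]
    rw [h1, map_mul_apply, Module.End.mul_apply, actsBy_proj h0, map_smul,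
      hC.actS.proj (by rw [← Matrix.mul_assoc, hF.ac, Matrix.zero_mul]) h0 D X₁, smul_smul,
      ← AddChar.map_add_eq_mul, fromCols_mul_fromRows, trace_add, add_comm]
  · intro X
    change R _ (proj χ₀ R (c * inc F d) a' D (Q w)) = _ • (proj χ₀ R (c * inc F d) a' D (Q w))
    rw [← map_smul, ← hC.actT X]
    refine map_proj_of_commute D fun Y => ?_
    have h1 : (1 + c * inc F d * Y * a') * (1 + a * X * ((inc F e₂)ᵀ * c')) =
        (1 + a * X * ((inc F e₂)ᵀ * c')) * (1 + c * inc F d * Y * a') *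
          (1 + (c * inc F d) * (Y * X) * ((inc F e₂)ᵀ * c')) := by
      have h2 : (inc F e₂)ᵀ * inc F d = 0 := inc_transpose_mul_of_disjoint fun j i => hd2 i j
      simp only [Matrix.mul_add, Matrix.add_mul, Matrix.mul_assoc, mul_mul_of_mul_eq hF.cc,
        mul_mul_of_mul_eq hF.aa, mul_mul_of_mul_eq hF.ac, mul_mul_of_mul_eq h2,
        Matrix.one_mul, Matrix.mul_one, Matrix.zero_mul, Matrix.mul_zero]
      abel
    rw [← map_mul_apply (1 + c * inc F d * Y * a'), h1, map_mul_apply, map_mul_apply]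
    congr 2
    exact (hC.fix_unip (fun i j => hd2 i j) (fun i j => hd2 i j) (fun i j h => by
      simpa using @hC.inj (.inr j) (.inl i) h) _).symm
  · intro h h1 h2 h3
    rw [inc_elim, mul_fromCols, fromCols_ext_iff] at h3
    obtain ⟨h3, h4⟩ := h3
    rw [Module.End.mul_apply]
    nth_rw 2 [← hC.fix h h1 h2 h3]
    refine map_proj_of_commute' _ D fun Y => ?_
    refine emb_mul_unip ?_ (mul_emb_of_eq_zero hF.ac h) Y
    rw [← Matrix.mul_assoc, emb_mul_self hF.cc, Matrix.mul_assoc, h4]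
  · intro g h1 h2 h3 u
    rw [mul_fromCols, fromCols_ext_iff] at h2
    obtain ⟨h2, h4⟩ := h2
    rw [Module.End.mul_apply, Module.End.mul_apply, hC.comm g h1 h2 h3]
    have hu : IsUnit g.det := by rw [h1]; exact isUnit_one
    refine proj_map D ⟨fun X => X * g⁻¹, fun X => X * g, fun X => ?_, fun X => ?_⟩
      (fun X => ?_) (fun X => ?_) _
    · simp [nonsing_inv_mul_cancel_right _ _ hu]
    · simp [mul_nonsing_inv_cancel_right _ _ hu]
    · simp only [Equiv.coe_fn_mk]
      rw [emb_mul_unip (C' := c * inc F d) (D' := g⁻¹ * a') (emb_mul_of_eq_zero ?_ g) ?_]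
      · simp only [Matrix.mul_assoc]
      · exact h0
      · rw [Matrix.mul_assoc, self_mul_emb hF.aa, nonsing_inv_mul_cancel_left _ _ hu]
    · simp only [Equiv.coe_fn_mk]
      rw [← Matrix.mul_assoc, trace_mul_comm, ← Matrix.mul_assoc]
      congr 2
      nth_rw 1 [← h4]
      rw [nonsing_inv_mul_cancel_left _ _ hu]

end Configurations

/-! ### Stabilizers and ranks in a maximal configuration -/

section Configurations

variable {F : Type*} [Field F] {ι α κ : Type} [Fintype ι] [Fintype α] [Fintype κ]
  [DecidableEq ι] [DecidableEq α] [DecidableEq κ] {V : Type*} [AddCommGroup V] [Module ℂ V]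
  {χ₀ : AddChar F ℂ} {R : Matrix ι ι F →* Module.End ℂ V} {a : Matrix ι α F}
  {a' : Matrix α ι F} {c : Matrix ι κ F} {c' : Matrix κ ι F} {w : V} {ν₁ ν₂ : Type}
  [Fintype ν₁] [Fintype ν₂] {e₁ : ν₁ → κ} {e₂ : ν₂ → κ}
  {S : Matrix α ν₁ F} {T : Matrix ν₂ α F} {Q : Module.End ℂ V}

/-- If the unipotent blocks joining `α` to a further block `d` of the size of `α` fix `Q w` whenever
this is compatible with `S` and `T`, then so does the stabilizer of `(S, T)` in the special linear
group of `α`: by Whitehead's identity these blocks generate it, up to the special linear group of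
the block `d`. -/
theorem Config.fix_stabilizer [DecidableEq ν₂] (hF : Frame a a' c c')
    (hC : Config χ₀ R a a' c c' w e₁ e₂ S T Q)
    {d : α → κ} (hd : Function.Injective (Sum.elim (Sum.elim e₁ e₂) d))
    (hU : ∀ Y : Matrix α α F, T * Y = 0 → R (1 + a * Y * ((inc F d)ᵀ * c')) (Q w) = Q w)
    (hL : ∀ Y : Matrix α α F, Y * S = 0 → R (1 + c * inc F d * Y * a') (Q w) = Q w)
    {g : Matrix α α F} (hg : g.det = 1) (hgS : g * S = S) (hgT : T * g = T) :
    R (emb a a' g) (Q w) = Q w := by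
  obtain ⟨r, -, C, D, C', D', hT, hC', hD'⟩ := exists_rank_factorization T
  have hu : IsUnit g.det := by rw [hg]; exact isUnit_one
  have hdd : (inc F d)ᵀ * inc F d = 1 :=
    inc_transpose_mul_self fun i j h => by simpa using @hd (.inr i) (.inr j) h
  have hde1 : (inc F d)ᵀ * inc F e₁ = 0 := inc_transpose_mul_of_disjoint fun i j h => by
    simpa using @hd (.inr i) (.inl (.inl j)) h
  have hde2 : (inc F e₂)ᵀ * inc F d = 0 := inc_transpose_mul_of_disjoint fun i j h => by
    simpa using @hd (.inl (.inr i)) (.inr j) h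
  -- `e` is a projection to the kernel of `T`.
  set e : Matrix α α F := 1 - D' * D with he
  set x : Matrix α α F := g - 1 with hx
  have hTx : T * x = 0 := by rw [hx, Matrix.mul_sub, hgT, Matrix.mul_one, sub_self]
  have hxS : x * S = 0 := by rw [hx, Matrix.sub_mul, hgS, Matrix.one_mul, sub_self]
  have hTe : T * e = 0 := by
    rw [he, hT, Matrix.mul_sub, Matrix.mul_one, Matrix.mul_assoc C, mul_mul_of_mul_eq hD',
      Matrix.one_mul, sub_self]
  have hex : e * x = x := by
    have : D * x = 0 := by
      rw [← Matrix.one_mul D, ← hC', Matrix.mul_assoc C', ← hT, Matrix.mul_assoc, hTx,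
        Matrix.mul_zero]
    rw [he, Matrix.sub_mul, Matrix.mul_assoc, this, Matrix.mul_zero, Matrix.one_mul, sub_zero]
  have hgiS : g⁻¹ * S = S := by
    nth_rw 1 [← hgS]
    exact nonsing_inv_mul_cancel_left _ _ hu
  have hgiT : T * g⁻¹ = T := by
    nth_rw 1 [← hgT]
    exact mul_nonsing_inv_cancel_right _ _ hu
  have hW := whitehead (a := a) (a' := a') (d := c * inc F d) (d' := (inc F d)ᵀ * c') hF.aa
    (by rw [Matrix.mul_assoc, mul_mul_of_mul_eq hF.cc, Matrix.one_mul, hdd])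
    (by rw [← Matrix.mul_assoc, hF.ac, Matrix.zero_mul])
    (by rw [Matrix.mul_assoc, hF.ca, Matrix.mul_zero]) e x (g := g) (gi := g⁻¹)
    (by rw [hex, hx]; abel) (mul_nonsing_inv _ hu) (nonsing_inv_mul _ hu)
  have h1 := congrArg (fun M => R M (Q w)) hW
  simp only [map_mul_apply] at h1
  rw [hU (-(g⁻¹ * e)) (by rw [Matrix.mul_neg, ← Matrix.mul_assoc, hgiT, hTe, neg_zero]), hL x hxS,
    hU e hTe, hL (-(x * g⁻¹)) (by rw [Matrix.neg_mul, Matrix.mul_assoc, hgiS, hxS, neg_zero])] at h1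
  have h2 := hC.fix (1 + inc F d * ((1 - x * g⁻¹ * e) - 1) * (inc F d)ᵀ) ?_ ?_ ?_
  · rw [emb, add_sub_cancel_left] at h2
    rw [emb]
    nth_rw 1 [← h2]
    simpa only [Matrix.mul_assoc] using h1.symm
  · rw [Matrix.mul_assoc, det_one_add_mul_comm, Matrix.mul_assoc, hdd, Matrix.mul_one,
      add_sub_cancel, det_one_sub_mul_comm, ← Matrix.mul_assoc, hex]
    have : 1 - x * g⁻¹ = g⁻¹ := by
      rw [hx, Matrix.sub_mul, mul_nonsing_inv _ hu, Matrix.one_mul]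
      abel
    rw [this, det_nonsing_inv, hg, Ring.inverse_one]
  · simp [Matrix.mul_add, Matrix.mul_assoc, mul_mul_of_mul_eq hde2]
  · simp [Matrix.add_mul, Matrix.mul_assoc, hde1]

/-- The ranks of the two characters of a configuration add up to at most the bound for the
`U`-rank: with the help of a further block `d`, a nondegenerate character of a block of that size
can be exhibited. -/
theorem Config.rank_add_rank_le [Fintype F] [DecidableEq ν₁] [DecidableEq ν₂] (hχ₀ : χ₀ ≠ 1)
    (hF : Frame a a' c c') (hC : Config χ₀ R a a' c c' w e₁ e₂ S T Q)
    {d : α → κ} (hd : Function.Injective (Sum.elim (Sum.elim e₁ e₂) d))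
    {k : ℕ} (hR : RankBound χ₀ R k) : S.rank + T.rank ≤ k := by
  have hd1 (i j) : e₁ i ≠ d j := fun h => by simpa using @hd (.inl (.inl i)) (.inr j) h
  have hd2 (i j) : e₂ i ≠ d j := fun h => by simpa using @hd (.inl (.inr i)) (.inr j) h
  have h12 (i j) : e₁ i ≠ e₂ j := fun h => by simpa using @hC.inj (.inl i) (.inr j) h
  have i1 : (inc F e₁)ᵀ * inc F e₁ = 1 :=
    inc_transpose_mul_self fun i j h => by simpa using @hC.inj (.inl i) (.inl j) h
  have i2 : (inc F e₂)ᵀ * inc F e₂ = 1 :=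
    inc_transpose_mul_self fun i j h => by simpa using @hC.inj (.inr i) (.inr j) h
  have i12 : (inc F e₁)ᵀ * inc F e₂ = 0 := inc_transpose_mul_of_disjoint h12
  have i21 : (inc F e₂)ᵀ * inc F e₁ = 0 := inc_transpose_mul_of_disjoint fun i j => (h12 j i).symm
  have i1d : (inc F e₁)ᵀ * inc F d = 0 := inc_transpose_mul_of_disjoint hd1
  have i2d : (inc F e₂)ᵀ * inc F d = 0 := inc_transpose_mul_of_disjoint hd2
  have id1 : (inc F d)ᵀ * inc F e₁ = 0 := inc_transpose_mul_of_disjoint fun i j => (hd1 j i).symm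
  have id2 : (inc F d)ᵀ * inc F e₂ = 0 := inc_transpose_mul_of_disjoint fun i j => (hd2 j i).symm
  have idd : (inc F d)ᵀ * inc F d = 1 :=
    inc_transpose_mul_self fun i j h => by simpa using @hd (.inr i) (.inr j) h
  obtain ⟨i, hi, S₁, C, L₁, A₁, hS, hL₁, hA₁⟩ := exists_rank_factorization S
  obtain ⟨j, hj, B₀, T₁, B₁, Q₁, hT, hB₁, hQ₁⟩ := exists_rank_factorization T
  -- Rows `c e₁ A₁` against columns `L₁ a'` see the character `S`, and rows `a Q₁` against columns
  -- `B₁ e₂ᵀ c'` see `T`; both become identity matrices. As `L₁ * Q₁` need not vanish, multiples of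
  -- the block `d`, which acts trivially, are added to make the two choices orthogonal.
  have hblock := hR.block hχ₀ (A₁ := c * inc F e₁ * A₁) (A₂ := a * Q₁ + c * inc F d * Q₁)
    (A' := fromRows (C * ((inc F e₁)ᵀ * c')) (T₁ * a'))
    (B₁ := L₁ * a' - L₁ * Q₁ * T₁ * ((inc F d)ᵀ * c')) (B₂ := B₁ * ((inc F e₂)ᵀ * c'))
    (B' := fromCols (a * S₁) (c * inc F e₂ * B₀)) (T₁ := 1) (T₂ := 1) hC.ne
    ?_ ?_ ?_ (by simp) (by simp) ?_ ?_ ?_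
  · simpa [hi, hj] using hblock
  · rw [fromRows_mul_fromCols, ← fromBlocks_zero, fromBlocks_inj]
    simp [Matrix.mul_add, Matrix.sub_mul, Matrix.mul_assoc, mul_mul_of_mul_eq hF.aa,
      mul_mul_of_mul_eq hF.ac, mul_mul_of_mul_eq hF.ca, mul_mul_of_mul_eq hF.cc,
      mul_mul_of_mul_eq i21, mul_mul_of_mul_eq i2d, mul_mul_of_mul_eq id1, mul_mul_of_mul_eq idd,
      hQ₁]
  · rw [fromRows_mul_fromCols, ← fromBlocks_one, fromBlocks_inj]
    simp [Matrix.mul_add, Matrix.mul_assoc, mul_mul_of_mul_eq hF.aa,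
      mul_mul_of_mul_eq hF.ac, mul_mul_of_mul_eq hF.ca, mul_mul_of_mul_eq hF.cc,
      mul_mul_of_mul_eq i1, mul_mul_of_mul_eq i1d, hQ₁, hA₁]
  · rw [fromRows_mul_fromCols, ← fromBlocks_one, fromBlocks_inj]
    simp [Matrix.sub_mul, Matrix.mul_assoc, mul_mul_of_mul_eq hF.aa,
      mul_mul_of_mul_eq hF.ac, mul_mul_of_mul_eq hF.ca, mul_mul_of_mul_eq hF.cc,
      mul_mul_of_mul_eq i2, mul_mul_of_mul_eq id2, hB₁, hL₁]
  · intro X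
    have h1 : 1 + c * inc F e₁ * A₁ * X * (L₁ * a' - L₁ * Q₁ * T₁ * ((inc F d)ᵀ * c')) =
        (1 + c * inc F e₁ * (A₁ * X * L₁) * a') *
          (1 + (c * inc F e₁) * (-(A₁ * X * L₁ * Q₁ * T₁)) * ((inc F d)ᵀ * c')) := by
      rw [unip_mul_unip (by rw [← Matrix.mul_assoc, hF.ac, Matrix.zero_mul])]
      simp only [Matrix.mul_sub, Matrix.mul_assoc, Matrix.neg_mul, Matrix.mul_neg]
      abel
    rw [h1, map_mul_apply, hC.fix_unip (fun i j => (hd1 i j).symm) (fun i j => (h12 i j).symm)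
      (fun i j => (hd1 i j).symm), hC.actS, Matrix.one_mul, hS, Matrix.mul_assoc,
      trace_mul_comm]
    simp only [Matrix.mul_assoc, mul_mul_of_mul_eq hA₁, Matrix.one_mul, hL₁, Matrix.mul_one]
  · intro X
    have h1 : 1 + (a * Q₁ + c * inc F d * Q₁) * X * (B₁ * ((inc F e₂)ᵀ * c')) =
        (1 + a * (Q₁ * X * B₁) * ((inc F e₂)ᵀ * c')) *
          (1 + (c * inc F d) * (Q₁ * X * B₁) * ((inc F e₂)ᵀ * c')) := by
      rw [unip_mul_unip (by
        rw [Matrix.mul_assoc, mul_mul_of_mul_eq hF.cc, Matrix.one_mul, i2d])]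
      simp only [Matrix.add_mul, Matrix.mul_assoc]
    rw [h1, map_mul_apply, hC.fix_unip (fun i j => hd2 j i) (fun i j => hd2 j i)
      (fun i j => (h12 i j).symm), hC.actT, Matrix.one_mul, hT, ← Matrix.mul_assoc,
      trace_mul_comm]
    simp only [Matrix.mul_assoc, mul_mul_of_mul_eq hB₁, Matrix.one_mul, mul_mul_of_mul_eq hQ₁]
  · rw [actsBy_zero_iff]
    intro X
    have := hC.fix_unip (e := e₁) (f := e₂) (fun i j => (h12 i j).symm)
      (fun i j => (h12 i j).symm) (fun i j => (h12 i j).symm) (A₁ * X * B₁)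
    simpa only [Matrix.mul_assoc] using this

end Configurations

/-! ### Invariant functionals from maximal configurations -/

section Separation

theorem exists_disjoint_injective {α κ ν : Type*} [Fintype α] [Fintype κ] [Fintype ν] {e : ν → κ} (he : Function.Injective e)
    (h : Fintype.card ν + Fintype.card α ≤ Fintype.card κ) :
    ∃ d : α → κ, Function.Injective (Sum.elim e d) := by
  classical
  obtain ⟨d⟩ : Nonempty (α ↪ {x // x ∉ Set.range e}) := by
    apply Function.Embedding.nonempty_of_card_le
    rw [Fintype.card_subtype_compl]
    have : Fintype.card {x // x ∈ Set.range e} = Fintype.card ν := Set.card_range_of_injective he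
    omega
  refine ⟨fun x => d x, he.sumElim (Subtype.val_injective.comp d.injective) fun i j h => ?_⟩
  exact (d j).2 ⟨i, h⟩

variable {F : Type*} [Field F] {ι α κ : Type} [Fintype ι] [Fintype α] [Fintype κ]
  [DecidableEq ι] [DecidableEq α] [DecidableEq κ] {V : Type*} [AddCommGroup V] [Module ℂ V]

/-- The vector `w` is detected by a linear functional that is invariant under all elements of the
special linear group of the block `α` fixing `k` vectors of `F^α`, the columns of `S`. By Frobenius
reciprocity, it is not annihilated by some intertwining map to a twist of `L²(F^α)^{⊗k}`. -/
def Detected (R : Matrix ι ι F →* Module.End ℂ V) (a : Matrix ι α F) (a' : Matrix α ι F) (k : ℕ)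
    (w : V) : Prop :=
  ∃ (σ : Type) (_ : Fintype σ) (S : Matrix α σ F) (l : V →ₗ[ℂ] ℂ), Fintype.card σ ≤ k ∧ l w ≠ 0 ∧
    ∀ g : Matrix α α F, g.det = 1 → g * S = S → ∀ u, l (R (emb a a' g) u) = l u

variable {χ₀ : AddChar F ℂ} {R : Matrix ι ι F →* Module.End ℂ V} {a : Matrix ι α F}
  {a' : Matrix α ι F} {c : Matrix ι κ F} {c' : Matrix κ ι F} {w : V} {ν₁ ν₂ : Type}
  [Fintype ν₁] [Fintype ν₂] {e₁ : ν₁ → κ} {e₂ : ν₂ → κ}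
  {S : Matrix α ν₁ F} {T : Matrix ν₂ α F} {Q : Module.End ℂ V}

/-- A configuration whose vector is fixed by the stabilizer of `(S, T)` yields a functional
invariant under that stabilizer; a Fourier transform in the variable `T` turns the row vectors in
`T` into column vectors `z`. -/
theorem Config.detected [Fintype F] [DecidableEq F] [DecidableEq ν₁] [DecidableEq ν₂]
    (hχ₀ : χ₀ ≠ 1) (hF : Frame a a' c c') (hC : Config χ₀ R a a' c c' w e₁ e₂ S T Q)
    (hfix : ∀ g : Matrix α α F, g.det = 1 → g * S = S → T * g = T →
      R (emb a a' g) (Q w) = Q w) {k : ℕ} (hk : S.rank + T.rank ≤ k) :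
    Detected R a a' k w := by
  classical
  obtain ⟨i, hi, S₁, C, L₁, A₁, hS, hL₁, hA₁⟩ := exists_rank_factorization S
  obtain ⟨j, hj, B₀, T₁, B₁, Q₁, hT, hB₁, hQ₁⟩ := exists_rank_factorization T
  obtain ⟨l₀, hl₀⟩ : ∃ l₀ : V →ₗ[ℂ] ℂ, l₀ (Q w) ≠ 0 := by
    by_contra! h
    exact hC.ne ((Module.forall_dual_apply_eq_zero_iff ℂ _).1 h)
  let H : Finset (Matrix α α F) := {g | g.det = 1 ∧ g * S = S}
  let l (z : Matrix α (Fin j) F) : V →ₗ[ℂ] ℂ :=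
    ∑ g ∈ H, χ₀ (T₁ * g * z).trace • (l₀ ∘ₗ Q ∘ₗ R (emb a a' g))
  have hl (z : Matrix α (Fin j) F) (u : V) :
      l z u = ∑ g ∈ H, χ₀ (T₁ * g * z).trace * l₀ (Q (R (emb a a' g) u)) := by
    simp [l, LinearMap.sum_apply]
  have hinv (z : Matrix α (Fin j) F) (g : Matrix α α F) (hg : g.det = 1) (hgS : g * S = S)
      (hgz : g * z = z) (u : V) : l z (R (emb a a' g) u) = l z u := by
    have hu : IsUnit g.det := by rw [hg]; exact isUnit_one
    have hgiS : g⁻¹ * S = S := by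
      nth_rw 1 [← hgS]
      exact nonsing_inv_mul_cancel_left _ _ hu
    rw [hl, hl]
    refine Finset.sum_bij' (fun x _ => x * g) (fun x _ => x * g⁻¹) ?_ ?_ ?_ ?_ ?_
    · intro x hx
      simp only [H, Finset.mem_filter, Finset.mem_univ, true_and] at hx ⊢
      rw [det_mul, hx.1, hg, Matrix.mul_assoc, hgS, hx.2]
      simp
    · intro x hx
      simp only [H, Finset.mem_filter, Finset.mem_univ, true_and] at hx ⊢
      rw [det_mul, hx.1, det_nonsing_inv, hg, Matrix.mul_assoc, hgiS, hx.2]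
      simp
    · intro x _
      exact mul_nonsing_inv_cancel_right _ _ hu
    · intro x _
      exact nonsing_inv_mul_cancel_right _ _ hu
    · intro x _
      rw [emb_mul hF.aa, map_mul_apply, Matrix.mul_assoc T₁ (x * g), Matrix.mul_assoc x g, hgz,
        Matrix.mul_assoc T₁]
  -- The Fourier transform recovers the sum over the stabilizer of `T`, which is not zero.
  have hsum : ∑ z, χ₀ (-(T₁ * z).trace) * l z w ≠ 0 := by
    simp_rw [hl, Finset.mul_sum]
    rw [Finset.sum_comm]
    have h1 (g : Matrix α α F) (hg : g ∈ H) :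
        ∑ z : Matrix α (Fin j) F, χ₀ (-(T₁ * z).trace) *
          (χ₀ (T₁ * g * z).trace * l₀ (Q (R (emb a a' g) w))) =
        if T₁ * g = T₁ then (Fintype.card (Matrix α (Fin j) F) : ℂ) * l₀ (Q w) else 0 := by
      have h2 (z : Matrix α (Fin j) F) : χ₀ (-(T₁ * z).trace) *
          (χ₀ (T₁ * g * z).trace * l₀ (Q (R (emb a a' g) w))) =
          χ₀ (z * (T₁ * g - T₁)).trace * l₀ (Q (R (emb a a' g) w)) := by
        rw [← mul_assoc, ← AddChar.map_add_eq_mul, trace_mul_comm z, Matrix.sub_mul, trace_sub,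
          neg_add_eq_sub]
      simp_rw [h2]
      rw [← Finset.sum_mul, sum_trace_char hχ₀]
      simp only [H, Finset.mem_filter, Finset.mem_univ, true_and] at hg
      simp only [sub_eq_zero]
      split_ifs with h
      · have hTg : T * g = T := by rw [hT, Matrix.mul_assoc, h]
        rw [hC.comm g hg.1 hg.2 hTg, hfix g hg.1 hg.2 hTg]
      · rw [zero_mul]
    rw [Finset.sum_congr rfl h1, ← Finset.sum_filter, Finset.sum_const, nsmul_eq_mul]
    refine mul_ne_zero ?_ (mul_ne_zero (by simp) hl₀)
    rw [Nat.cast_ne_zero, Finset.card_ne_zero]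
    exact ⟨1, by simp [H]⟩
  obtain ⟨z, -, hz⟩ := Finset.exists_ne_zero_of_sum_ne_zero hsum
  refine ⟨Fin i ⊕ Fin j, inferInstance, fromCols S₁ z, l z, by simpa [hi, hj] using hk,
    right_ne_zero_of_mul hz, fun g hg hgS u => ?_⟩
  rw [mul_fromCols, fromCols_ext_iff] at hgS
  exact hinv z g hg (by rw [hS, ← Matrix.mul_assoc, hgS.1]) hgS.2 u

/-- A vector fixed by the special linear group of a sufficiently large block `κ` is detected. In a
configuration of maximal total rank, adding a further block to `ν₁` or `ν₂` does not enlarge the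
image of `S` or shrink the kernel of `T`, which makes `Config.fix_stabilizer` applicable. -/
theorem detected_of_fixed [Fintype F] (hχ₀ : χ₀ ≠ 1) (hF : Frame a a' c c') {k : ℕ}
    (hR : RankBound χ₀ R k)
    (hcard : Fintype.card α * (2 * Fintype.card α) + Fintype.card α ≤ Fintype.card κ)
    (hw : w ≠ 0) (hfix : ∀ h : Matrix κ κ F, h.det = 1 → R (emb c c' h) w = w) :
    Detected R a a' k w := by
  classical
  let P (r : ℕ) : Prop := ∃ (ν₁ ν₂ : Type) (_ : Fintype ν₁) (_ : Fintype ν₂) (e₁ : ν₁ → κ)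
    (e₂ : ν₂ → κ) (S : Matrix α ν₁ F) (T : Matrix ν₂ α F) (Q : Module.End ℂ V),
    Config χ₀ R a a' c c' w e₁ e₂ S T Q ∧ r = S.rank + T.rank ∧
      Fintype.card ν₁ + Fintype.card ν₂ ≤ Fintype.card α * r
  have hP0 : P 0 := by
    refine ⟨Empty, Empty, inferInstance, inferInstance, Empty.elim, Empty.elim, 0, 0, 1,
      ⟨?_, ?_, ?_, ?_, ?_, ?_⟩, by simp, by simp⟩
    · rintro (⟨⟨⟩⟩ | ⟨⟨⟩⟩)
    · exact hw
    · intro X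
      have : c * inc F (Empty.elim : Empty → κ) * X = (0 : Matrix ι α F) := by
        ext i j; simp [mul_apply]
      simp [this]
    · intro X
      have : X * ((inc F (Empty.elim : Empty → κ))ᵀ * c') = (0 : Matrix α ι F) := by
        ext i j; simp [mul_apply]
      simp [Matrix.mul_assoc, this]
    · intro h hh _ _
      exact hfix h hh
    · intro g _ _ _ u
      rfl
  have hPle (r : ℕ) (hr : P r) : r ≤ 2 * Fintype.card α := by
    obtain ⟨ν₁, ν₂, _, _, e₁, e₂, S, T, Q, -, rfl, -⟩ := hr
    have h1 := S.rank_le_card_height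
    have h2 := T.rank_le_card_width
    omega
  obtain ⟨r, hr, hmax⟩ : ∃ r, P r ∧ ∀ r', P r' → r' ≤ r :=
    ⟨Nat.findGreatest P (2 * Fintype.card α), Nat.findGreatest_spec (Nat.zero_le _) hP0,
      fun r' hr' => Nat.le_findGreatest (hPle r' hr') hr'⟩
  have hr2 := hPle r hr
  obtain ⟨ν₁, ν₂, _, _, e₁, e₂, S, T, Q, hC, hrk, hν⟩ := hr
  have hν' : Fintype.card α * r ≤ Fintype.card α * (2 * Fintype.card α) :=
    Nat.mul_le_mul_left _ hr2
  obtain ⟨d, hd⟩ := exists_disjoint_injective (α := α) hC.inj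
    (by rw [Fintype.card_sum]; omega)
  have hstep {r' : ℕ} (h : r < r') :
      Fintype.card α * r + Fintype.card α ≤ Fintype.card α * r' := by
    rw [← Nat.mul_succ]
    exact Nat.mul_le_mul_left _ h
  have hU (Y : Matrix α α F) (hY : T * Y = 0) :
      R (1 + a * Y * ((inc F d)ᵀ * c')) (Q w) = Q w := by
    refine fixed_of_proj hχ₀ (by rw [Matrix.mul_assoc, hF.ca, Matrix.mul_zero]) fun D hD => ?_
    have hC' := hC.extend_right hF hd hD
    have h1 : (fromRows T D).rank ≤ T.rank := by
      by_contra! h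
      have := hmax _ ⟨_, _, _, _, _, _, _, _, _, hC', rfl, by
        have := hstep (r' := S.rank + (fromRows T D).rank) (by omega)
        rw [Fintype.card_sum]
        omega⟩
      omega
    rw [mul_eq_zero_of_rank_fromRows_le h1 hY, trace_zero, AddChar.map_zero_eq_one]
  have hL (Y : Matrix α α F) (hY : Y * S = 0) :
      R (1 + c * inc F d * Y * a') (Q w) = Q w := by
    refine fixed_of_proj hχ₀ (by rw [← Matrix.mul_assoc, hF.ac, Matrix.zero_mul]) fun D hD => ?_
    have hC' := hC.extend_left hF hd hD
    have h1 : (fromCols S D).rank ≤ S.rank := by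
      by_contra! h
      have := hmax _ ⟨_, _, _, _, _, _, _, _, _, hC', rfl, by
        have := hstep (r' := (fromCols S D).rank + T.rank) (by omega)
        rw [Fintype.card_sum]
        omega⟩
      omega
    rw [trace_mul_comm, mul_eq_zero_of_rank_fromCols_le h1 hY, trace_zero,
      AddChar.map_zero_eq_one]
  exact hC.detected hχ₀ hF (fun g hg hgS hgT => hC.fix_stabilizer hF hd hU hL hg hgS hgT)
    (hC.rank_add_rank_le hχ₀ hF hd hR)

end Separation

/-! ### Reduction of the rank along a root group -/

section Emb

variable {F : Type*} [Field F] {ι μ : Type*} [Fintype μ] [DecidableEq ι] [DecidableEq μ]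

theorem emb_one {A : Matrix ι μ F} {A' : Matrix μ ι F} : emb A A' 1 = 1 := by
  simp [emb]

theorem emb_emb {α : Type*} [Fintype α] [DecidableEq α] {P : Matrix ι μ F} {P' : Matrix μ ι F}
    {a : Matrix μ α F} {a' : Matrix α μ F} (g : Matrix α α F) :
    emb P P' (emb a a' g) = emb (P * a) (a' * P') g := by
  simp only [emb, add_sub_cancel_left, Matrix.mul_assoc]

end Emb

section Reduction

variable {F : Type*} [Field F] {ι μ : Type} [Fintype ι] [Fintype μ]
  [DecidableEq ι] [DecidableEq μ] {V : Type*} [AddCommGroup V] [Module ℂ V]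

/-- A row index (given by `A`), a column index (given by `B`) and a coordinate block `μ` (given by
`P`) that are disjoint from each other, together with dual data. -/
structure Corner (A : Matrix ι Unit F) (A' : Matrix Unit ι F) (B : Matrix Unit ι F)
    (B' : Matrix ι Unit F) (P : Matrix ι μ F) (P' : Matrix μ ι F) : Prop where
  aa : A' * A = 1
  bb : B * B' = 1
  pp : P' * P = 1
  pa : P' * A = 0
  bp : B * P = 0
  ba : B * A = 0
  ap : A' * P = 0
  pb : P' * B' = 0

variable (χ₀ : AddChar F ℂ) (R : Matrix ι ι F →* Module.End ℂ V) (A : Matrix ι Unit F)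
  {A' : Matrix Unit ι F} (B : Matrix Unit ι F) {B' : Matrix ι Unit F} {P : Matrix ι μ F}
  (P' : Matrix μ ι F) (T : Matrix Unit Unit F)

/-- The vectors on which the root group at the corner `(A, B)` acts by the character `T`, and the
remaining part of the row `A` acts trivially. -/
def cornerSpace : Submodule ℂ V where
  carrier := {v | ActsBy χ₀ R A B T v ∧ ActsBy χ₀ R A P' 0 v}
  add_mem' := fun hv hw => ⟨fun X => by rw [map_add, hv.1, hw.1, smul_add],
    fun X => by rw [map_add, hv.2, hw.2, smul_add]⟩
  zero_mem' := ⟨fun X => by simp, fun X => by simp⟩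
  smul_mem' := fun z v hv => ⟨fun X => by rw [map_smul, hv.1, smul_comm],
    fun X => by rw [map_smul, hv.2, smul_comm]⟩

variable {χ₀ R A B P' T}

theorem Corner.map_mem (h : Corner A A' B B' P P') {v : V} (hv : v ∈ cornerSpace χ₀ R A B P' T)
    (g : Matrix μ μ F) : R (emb P P' g) v ∈ cornerSpace χ₀ R A B P' T := by
  have h1 : emb P P' g * A = A := emb_mul_of_eq_zero h.pa g
  refine ⟨fun X => ?_, fun X => ?_⟩
  · rw [← map_mul_apply, ← emb_mul_unip h1 (mul_emb_of_eq_zero h.bp g), map_mul_apply, hv.1,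
      map_smul]
  · rw [← map_mul_apply, ← emb_mul_unip h1 (self_mul_emb h.pp g), ← Matrix.mul_assoc,
      Matrix.mul_assoc A, map_mul_apply, actsBy_zero_iff.1 hv.2]
    simp

/-- The smaller group of matrices on the block `μ` acts on `cornerSpace`. -/
noncomputable def Corner.action (h : Corner A A' B B' P P') (χ₀ : AddChar F ℂ)
    (R : Matrix ι ι F →* Module.End ℂ V) (T : Matrix Unit Unit F) :
    Matrix μ μ F →* Module.End ℂ (cornerSpace χ₀ R A B P' T) where
  toFun g := (R (emb P P' g)).restrict fun _ hv => h.map_mem hv g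
  map_one' := by ext v; simp [emb_one]
  map_mul' g g' := by
    ext v
    simp [emb_mul h.pp]

theorem Corner.action_apply (h : Corner A A' B B' P P') (g : Matrix μ μ F)
    (v : cornerSpace χ₀ R A B P' T) : (h.action χ₀ R T g v : V) = R (emb P P' g) v :=
  rfl

theorem Corner.one_le (h : Corner A A' B B' P P') {k : ℕ} (hR : RankBound χ₀ R k)
    (hT : IsUnit T.det) {v : V} (hv : v ≠ 0) (hv' : v ∈ cornerSpace χ₀ R A B P' T) : 1 ≤ k := by
  simpa using hR Unit A A' B B' T v h.ba h.aa h.bb hT hv hv'.1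

/-- Passing to `cornerSpace` lowers the bound for the rank by one. -/
theorem Corner.rankBound [Fintype F] (hχ₀ : χ₀ ≠ 1) (h : Corner A A' B B' P P') {k : ℕ}
    (hR : RankBound χ₀ R (k + 1)) (hT : IsUnit T.det) : RankBound χ₀ (h.action χ₀ R T) k := by
  intro τ _ _ A₂ A₂' B₂ B₂' T₂ v h1 h2 h3 h4 h5 h6
  have hv : (v : V) ≠ 0 := by simpa using h5
  have := hR.block hχ₀ (A₁ := A) (A₂ := P * A₂) (A' := fromRows A' (A₂' * P')) (B₁ := B)
    (B₂ := B₂ * P') (B' := fromCols B' (P * B₂')) (T₁ := T) (T₂ := T₂) hv ?_ ?_ ?_ hT h4 v.2.1 ?_ ?_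
  · rw [Fintype.card_unit] at this
    omega
  · rw [fromRows_mul_fromCols, h.ba, ← Matrix.mul_assoc, h.bp, Matrix.mul_assoc, h.pa,
      Matrix.mul_assoc, mul_mul_of_mul_eq h.pp, Matrix.one_mul, h1]
    simp
  · rw [fromRows_mul_fromCols, h.aa, ← Matrix.mul_assoc, h.ap, Matrix.mul_assoc, h.pa,
      Matrix.mul_assoc, mul_mul_of_mul_eq h.pp, Matrix.one_mul, h2]
    simp
  · rw [fromRows_mul_fromCols, h.bb, ← Matrix.mul_assoc, h.bp, Matrix.mul_assoc, h.pb,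
      Matrix.mul_assoc, mul_mul_of_mul_eq h.pp, Matrix.one_mul, h3]
    simp
  · intro X
    have := congrArg Subtype.val (h6 X)
    rw [Corner.action_apply, emb, add_sub_cancel_left, Submodule.coe_smul] at this
    simpa only [Matrix.mul_assoc] using this
  · rw [actsBy_zero_iff]
    intro X
    have := actsBy_zero_iff.1 v.2.2 (X * B₂)
    simpa only [Matrix.mul_assoc] using this

variable [Fintype F]

/-- Project to the isotypic components for `T` at the corner and for `s` along the rest of the row,
then translate by a unipotent element whose conjugation moves the character `s` to the trivial one:
the result is in `cornerSpace`. -/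
theorem Corner.mem_cornerSpace (h : Corner A A' B B' P P') (hT : IsUnit T.det) (s : Matrix μ Unit F)
    (u : V) : R (1 + P * (-(s * T⁻¹)) * B) (proj χ₀ R A P' s (proj χ₀ R A B T u)) ∈
      cornerSpace χ₀ R A B P' T := by
  set y := -(s * T⁻¹) with hy
  have hyT : y * T = -s := by rw [hy, Matrix.neg_mul, nonsing_inv_mul_cancel_right _ _ hT]
  have h1 : ActsBy χ₀ R A B T (proj χ₀ R A P' s (proj χ₀ R A B T u)) :=
    (actsBy_proj h.ba T u).proj h.pa h.ba s
  refine ⟨fun X => ?_, actsBy_zero_iff.2 fun X => ?_⟩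
  · rw [← map_mul_apply, (unip_commute h.bp h.ba X y).eq, map_mul_apply, h1, map_smul]
  · have h2 : (1 + A * X * P') * (1 + P * y * B) =
        (1 + P * y * B) * ((1 + A * X * P') * (1 + A * (X * y) * B)) := by
      simp only [Matrix.mul_add, Matrix.add_mul, Matrix.mul_assoc, mul_mul_of_mul_eq h.pp,
        mul_mul_of_mul_eq h.pa, mul_mul_of_mul_eq h.ba,
        Matrix.one_mul, Matrix.mul_one, Matrix.zero_mul, Matrix.mul_zero]
      abel
    rw [← map_mul_apply, h2, map_mul_apply, map_mul_apply, h1, map_smul, actsBy_proj h.pa,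
      smul_smul, ← AddChar.map_add_eq_mul, ← Matrix.mul_assoc T, trace_mul_comm (T * X),
      ← Matrix.mul_assoc, hyT, Matrix.neg_mul, trace_neg, neg_add_cancel, AddChar.map_zero_eq_one,
      one_smul]

/-- The map from `V` to `cornerSpace` given by `Corner.mem_cornerSpace` commutes with the
matrices on `μ` that fix `s`. -/
theorem Corner.map_comm (h : Corner A A' B B' P P') (s : Matrix μ Unit F)
    {G : Matrix μ μ F} (hG : IsUnit G.det) (hGs : G * s = s) (u : V) :
    R (1 + P * (-(s * T⁻¹)) * B) (proj χ₀ R A P' s (proj χ₀ R A B T (R (emb P P' G) u))) =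
    R (emb P P' G) (R (1 + P * (-(s * T⁻¹)) * B) (proj χ₀ R A P' s (proj χ₀ R A B T u))) := by
  have h1 : emb P P' G * A = A := emb_mul_of_eq_zero h.pa G
  have h2 : B * emb P P' G = B := mul_emb_of_eq_zero h.bp G
  have hGy : G * (-(s * T⁻¹)) = -(s * T⁻¹) := by rw [Matrix.mul_neg, ← Matrix.mul_assoc, hGs]
  have hGis : G⁻¹ * s = s := by
    nth_rw 1 [← hGs]
    exact nonsing_inv_mul_cancel_left _ _ hG
  rw [← map_proj_of_commute' u T fun X => emb_mul_unip h1 h2 X,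
    proj_map s ⟨fun X => X * G⁻¹, fun X => X * G, fun X => ?_, fun X => ?_⟩
      (fun X => ?_) (fun X => ?_), ← map_mul_apply, ← map_mul_apply,
    emb_mul_unip (emb_mul_self h.pp G) h2, Matrix.mul_assoc P G, hGy]
  · simp [nonsing_inv_mul_cancel_right _ _ hG]
  · simp [mul_nonsing_inv_cancel_right _ _ hG]
  · simp only [Equiv.coe_fn_mk]
    rw [emb_mul_unip (C' := A) (D' := G⁻¹ * P') h1 ?_]
    · simp only [Matrix.mul_assoc]
    · rw [Matrix.mul_assoc, self_mul_emb h.pp, nonsing_inv_mul_cancel_left _ _ hG]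
  · simp only [Equiv.coe_fn_mk]
    rw [← Matrix.mul_assoc, trace_mul_comm, ← Matrix.mul_assoc, hGis]

end Reduction

section Detection

variable {F : Type*} [Field F]

/-- A vector fixed by the root groups in the block `κ` is fixed by its special linear group. -/
theorem fixed_of_transvections {ι κ : Type} [Fintype ι] [Fintype κ] [DecidableEq ι]
    [DecidableEq κ] {V : Type*} [AddCommGroup V] [Module ℂ V] {R : Matrix ι ι F →* Module.End ℂ V}
    {c : Matrix ι κ F} {c' : Matrix κ ι F} (hc : c' * c = 1) {w : V}
    (h : ∀ i j x, i ≠ j → R (emb c c' (transvection i j x)) w = w) {M : Matrix κ κ F}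
    (hM : M.det = 1) : R (emb c c' M) w = w := by
  refine Submonoid.closure_induction (motive := fun M _ => R (emb c c' M) w = w) ?_ ?_ ?_
    (mem_closure_transvection hM)
  · rintro _ ⟨i, j, x, hij, rfl⟩
    exact h i j x hij
  · simp [emb_one]
  · intro x y _ _ hx hy
    rw [emb_mul hc, map_mul_apply, hy, hx]

theorem transvection_eq_inc {κ : Type} [Fintype κ] [DecidableEq κ] (i j : κ) (x : F) :
    transvection i j x = 1 + inc F (fun _ : Unit => i) * (of fun _ _ => x : Matrix Unit Unit F) *
      (inc F (fun _ : Unit => j))ᵀ := by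
  ext p q
  simp [transvection, inc, mul_apply, single_apply, one_apply]
  split_ifs <;> simp_all

theorem Frame.corner {ι α κ κ' : Type} [Fintype ι] [Fintype α] [Fintype κ] [DecidableEq α]
    [DecidableEq κ] [Fintype κ'] [DecidableEq κ'] {a : Matrix ι α F} {a' : Matrix α ι F}
    {c : Matrix ι κ F} {c' : Matrix κ ι F} (hF : Frame a a' c c') {e : κ' → κ}
    (he : Function.Injective e) {i j : κ} (hij : i ≠ j) (hi : ∀ y, e y ≠ i) (hj : ∀ y, e y ≠ j) :
    Corner (c * inc F (fun _ : Unit => i)) ((inc F (fun _ : Unit => i))ᵀ * c')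
      ((inc F (fun _ : Unit => j))ᵀ * c') (c * inc F (fun _ : Unit => j))
      (fromCols a (c * inc F e)) (fromRows a' ((inc F e)ᵀ * c')) := by
  have hii : (inc F fun _ : Unit => i)ᵀ * inc F (fun _ : Unit => i) = 1 :=
    inc_transpose_mul_self fun _ _ _ => rfl
  have hjj : (inc F fun _ : Unit => j)ᵀ * inc F (fun _ : Unit => j) = 1 :=
    inc_transpose_mul_self fun _ _ _ => rfl
  have hji : (inc F fun _ : Unit => j)ᵀ * inc F (fun _ : Unit => i) = 0 :=
    inc_transpose_mul_of_disjoint fun _ _ => hij.symm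
  have hvv : (inc F e)ᵀ * inc F e = 1 :=
    inc_transpose_mul_self he
  have hvi : (inc F e)ᵀ * inc F (fun _ : Unit => i) = 0 :=
    inc_transpose_mul_of_disjoint fun y _ => hi y
  have hvj : (inc F e)ᵀ * inc F (fun _ : Unit => j) = 0 :=
    inc_transpose_mul_of_disjoint fun y _ => hj y
  have hiv : (inc F (fun _ : Unit => i))ᵀ * inc F e = 0 :=
    inc_transpose_mul_of_disjoint fun _ y => (hi y).symm
  have hjv : (inc F (fun _ : Unit => j))ᵀ * inc F e = 0 :=
    inc_transpose_mul_of_disjoint fun _ y => (hj y).symm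
  constructor <;>
  simp only [fromRows_mul, mul_fromCols, Matrix.mul_assoc, hF.aa,
    mul_mul_of_mul_eq hF.cc, hF.ca, mul_mul_of_mul_eq hF.ac, hii, hjj, hji, hvv, hvi, hvj,
    hiv, hjv, Matrix.one_mul, Matrix.mul_zero, Matrix.zero_mul, fromRows_zero, fromCols_zero,
    fromCols_fromRows_eq_fromBlocks, fromBlocks_one]

/-- A nonzero vector of a representation of rank at most `k` of a sufficiently large general linear
group is detected. If the block `κ` contains a root group acting on the vector nontrivially, passing
to `cornerSpace` reduces `k` by one, at the cost of one additional vector in `F^α`. -/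
theorem detected.{u} [Fintype F] {α : Type} [Fintype α] [DecidableEq α] {χ₀ : AddChar F ℂ}
    (hχ₀ : χ₀ ≠ 1) (k : ℕ) :
    ∀ {ι κ : Type} [Fintype ι] [Fintype κ] [DecidableEq ι] [DecidableEq κ] {V : Type u}
      [AddCommGroup V] [Module ℂ V] {R : Matrix ι ι F →* Module.End ℂ V} {a : Matrix ι α F}
      {a' : Matrix α ι F} {c : Matrix ι κ F} {c' : Matrix κ ι F} {w : V},
      Frame a a' c c' → RankBound χ₀ R k →
      Fintype.card α * (2 * Fintype.card α) + Fintype.card α + 2 * k ≤ Fintype.card κ →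
      w ≠ 0 → Detected R a a' k w := by
  induction k using Nat.strong_induction_on with
  | _ k ih => ?_
  intro ι κ _ _ _ _ V _ _ R a a' c c' w hF hR hcard hw
  classical
  by_cases hfix : ∀ (i j : κ) (x : F), i ≠ j → R (emb c c' (transvection i j x)) w = w
  · exact detected_of_fixed hχ₀ hF hR (by omega) hw fun h hh =>
      fixed_of_transvections hF.cc hfix hh
  push Not at hfix
  obtain ⟨i, j, x, hij, hx⟩ := hfix
  let κ' := {y : κ // y ≠ i ∧ y ≠ j}
  set A : Matrix ι Unit F := c * inc F (fun _ : Unit => i) with hA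
  set B : Matrix Unit ι F := (inc F (fun _ : Unit => j))ᵀ * c' with hB
  set P : Matrix ι (α ⊕ κ') F := fromCols a (c * inc F (Subtype.val : κ' → κ)) with hP
  set P' : Matrix (α ⊕ κ') ι F := fromRows a' ((inc F (Subtype.val : κ' → κ))ᵀ * c') with hP'
  have h : Corner A ((inc F (fun _ : Unit => i))ᵀ * c') B (c * inc F (fun _ : Unit => j)) P P' :=
    hF.corner Subtype.val_injective hij (fun y => y.2.1) fun y => y.2.2
  -- The root group of `(i, j)` does not fix `w`, so a nontrivial character of it occurs in `w`.
  obtain ⟨T, hT, hTu⟩ : ∃ T : Matrix Unit Unit F, proj χ₀ R A B T w ≠ 0 ∧ IsUnit T.det := by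
    by_contra! hcon
    apply hx
    rw [transvection_eq_inc, emb, add_sub_cancel_left]
    have := fixed_of_proj (R := R) (v := w) (A := A) (B := B) (Y := of fun _ _ => x) hχ₀ h.ba
      fun T hT => by
        have h1 := hcon T hT
        rw [isUnit_iff_ne_zero, not_not, det_unique] at h1
        have h2 : T = 0 := by ext _ _; exact h1
        rw [h2, Matrix.zero_mul, trace_zero, AddChar.map_zero_eq_one]
    simpa only [hA, hB, Matrix.mul_assoc] using this
  obtain ⟨s, hs⟩ := exists_proj_ne_zero (R := R) hχ₀ hT A P'
  let Op : V →ₗ[ℂ] cornerSpace χ₀ R A B P' T :=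
    LinearMap.codRestrict _ (R (1 + P * (-(s * T⁻¹)) * B) ∘ₗ proj χ₀ R A P' s ∘ₗ proj χ₀ R A B T)
      fun u => h.mem_cornerSpace hTu s u
  have hOp (u : V) : (Op u : V) =
    R (1 + P * (-(s * T⁻¹)) * B) (proj χ₀ R A P' s (proj χ₀ R A B T u)) := rfl
  have hOpw : (Op w : V) ≠ 0 := by
    intro h0
    rw [hOp] at h0
    have h1 := congrArg (R (1 + P * (s * T⁻¹) * B)) h0
    rw [← map_mul_apply, unip_add h.bp, add_neg_cancel, Matrix.mul_zero, Matrix.zero_mul, add_zero,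
      map_one, map_zero] at h1
    exact hs h1
  obtain ⟨k, rfl⟩ := Nat.exists_eq_add_of_le' (h.one_le hR hTu hOpw (Op w).2)
  let a₀ : Matrix (α ⊕ κ') α F := fromRows 1 0
  let a₀' : Matrix α (α ⊕ κ') F := fromCols 1 0
  have hF₀ : Frame a₀ a₀' (fromRows 0 1 : Matrix (α ⊕ κ') κ' F) (fromCols 0 1) := by
    constructor <;> simp [a₀, a₀', fromCols_mul_fromRows]
  have hcard' : Fintype.card κ ≤ Fintype.card κ' + 2 := by
    have : Fintype.card κ' = Fintype.card κ - ({i, j} : Finset κ).card := by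
      rw [Fintype.card_subtype, ← Finset.card_compl]
      congr 1
      ext y
      simp
    have := Finset.card_le_two (a := i) (b := j)
    omega
  obtain ⟨σ, _, S, l, hσ, hl, hinv⟩ := ih k (Nat.lt_succ_self k) hF₀ (h.rankBound hχ₀ hR hTu)
    (by omega) (w := Op w) (by simpa using hOpw)
  refine ⟨σ ⊕ Unit, inferInstance, fromCols S (a₀' * s), l ∘ₗ Op, by simpa using hσ, hl,
    fun g hg hgS u => ?_⟩
  rw [mul_fromCols, fromCols_ext_iff] at hgS
  have hGs : emb a₀ a₀' g * s = s := by
    rw [emb, Matrix.add_mul, Matrix.one_mul, Matrix.mul_assoc, Matrix.mul_assoc, Matrix.sub_mul,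
      hgS.2, Matrix.one_mul, sub_self, Matrix.mul_zero, add_zero]
  have hGu : IsUnit (emb a₀ a₀' g).det := by
    rw [emb, Matrix.mul_assoc, det_one_add_mul_comm, Matrix.mul_assoc, hF₀.aa, Matrix.mul_one,
      add_sub_cancel, hg]
    exact isUnit_one
  have hGa : emb P P' (emb a₀ a₀' g) = emb a a' g := by
    rw [emb_emb]
    simp [a₀, a₀', hP, hP', fromCols_mul_fromRows]
  have h1 : Op (R (emb a a' g) u) = h.action χ₀ R T (emb a₀ a₀' g) (Op u) := by
    ext
    rw [h.action_apply, hOp, hOp, ← hGa, h.map_comm s hGu hGs]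
  rw [LinearMap.comp_apply, h1, hinv g hg hgS.1]
  rfl

end Detection

/-! ### Comparison of the rank bound with the `U`-rank -/

section Extension

variable {F : Type*} [Field F] {ι : Type*} [Fintype ι] [DecidableEq ι]
  {V : Type*} [AddCommGroup V] [Module ℂ V]

open Classical in
/-- A representation of a general linear group, extended by zero to singular matrices. -/
noncomputable def extendByZero (ρ : Representation ℂ (GL ι F) V) :
    Matrix ι ι F →* Module.End ℂ V where
  toFun M := if h : IsUnit M then ρ h.unit else 0
  map_one' := by
    rw [dif_pos isUnit_one]
    convert map_one ρ
    ext1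
    rfl
  map_mul' M N := by
    by_cases hM : IsUnit M
    · by_cases hN : IsUnit N
      · rw [dif_pos hM, dif_pos hN, dif_pos (hM.mul hN), ← map_mul]
        congr 1
        ext1
        rfl
      · rw [dif_neg hN, mul_zero, dif_neg fun h => hN ?_]
        rw [isUnit_iff_isUnit_det, det_mul] at h
        exact (isUnit_iff_isUnit_det _).2 (IsUnit.mul_iff.1 h).2
    · rw [dif_neg hM, zero_mul, dif_neg fun h => hM ?_]
      rw [isUnit_iff_isUnit_det, det_mul] at h
      exact (isUnit_iff_isUnit_det _).2 (IsUnit.mul_iff.1 h).1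

theorem extendByZero_coe (ρ : Representation ℂ (GL ι F) V) (g : GL ι F) :
    extendByZero ρ (g : Matrix ι ι F) = ρ g :=
  (dif_pos g.isUnit).trans (congrArg ρ (Units.ext rfl))

end Extension

section URank

variable {F : Type*} [Field F]

/-- Linearly independent columns `A` in the kernel of linearly independent rows `B` can be
completed to an invertible matrix in such a way that `B` becomes a row of coordinate vectors. -/
theorem exists_adapted_basis {ι τ : Type} [Fintype ι] [Fintype τ] [DecidableEq ι]
    [DecidableEq τ] {A : Matrix ι τ F} {A' : Matrix τ ι F} {B : Matrix τ ι F} {B' : Matrix ι τ F}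
    (h : B * A = 0) (hA : A' * A = 1) (hB : B * B' = 1) :
    ∃ (s : ℕ) (H : Matrix ι ((τ ⊕ τ) ⊕ Fin s) F) (H' : Matrix ((τ ⊕ τ) ⊕ Fin s) ι F),
      H * H' = 1 ∧ H' * H = 1 ∧ H.submatrix id (Sum.inl ∘ Sum.inl) = A ∧
        H'.submatrix (Sum.inl ∘ Sum.inr) id = B := by
  -- `A₁` is dual to `A` and vanishes on `B'`; `M` is the projection away from `A` and `B'`.
  set A₁ : Matrix τ ι F := A' - A' * B' * B with hA₁
  have h1 : A₁ * A = 1 := by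
    rw [hA₁, Matrix.sub_mul, Matrix.mul_assoc _ B, h, Matrix.mul_zero, sub_zero, hA]
  have h2 : A₁ * B' = 0 := by
    rw [hA₁, Matrix.sub_mul, Matrix.mul_assoc _ B, hB, Matrix.mul_one, sub_self]
  set M : Matrix ι ι F := 1 - (A * A₁ + B' * B) with hM
  have hBM : B * M = 0 := by
    simp [hM, Matrix.mul_sub, Matrix.mul_add, mul_mul_of_mul_eq h, mul_mul_of_mul_eq hB]
  have hAM : A₁ * M = 0 := by
    simp [hM, Matrix.mul_sub, Matrix.mul_add, mul_mul_of_mul_eq h1, mul_mul_of_mul_eq h2]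
  have hMA : M * A = 0 := by
    simp [hM, Matrix.sub_mul, Matrix.add_mul, Matrix.mul_assoc, h, h1]
  have hMB : M * B' = 0 := by
    simp [hM, Matrix.sub_mul, Matrix.add_mul, Matrix.mul_assoc, hB, h2]
  have hMM : M * M = M := by
    nth_rw 1 [hM]
    simp [Matrix.sub_mul, Matrix.add_mul, Matrix.mul_assoc, hBM, hAM]
  obtain ⟨s, -, C, D, C', D', hCD, hC, hD⟩ := exists_rank_factorization M
  have hr {γ : Type} (N : Matrix γ ι F) (hN : N * M = 0) : N * C = 0 := by
    rw [← Matrix.mul_one C, ← hD, ← Matrix.mul_assoc C, ← hCD, ← Matrix.mul_assoc, hN,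
      Matrix.zero_mul]
  have hl {γ : Type} (N : Matrix ι γ F) (hN : M * N = 0) : D * N = 0 := by
    rw [← Matrix.one_mul D, ← hC, Matrix.mul_assoc C', ← hCD, Matrix.mul_assoc, hN,
      Matrix.mul_zero]
  have hDC : D * C = 1 := by
    have : C' * (M * M) * D' = C' * M * D' := by rw [hMM]
    rw [hCD] at this
    simpa [Matrix.mul_assoc, mul_mul_of_mul_eq hC, hD] using this
  refine ⟨s, fromCols (fromCols A B') C, fromRows (fromRows A₁ B) D, ?_, ?_, ?_, ?_⟩
  · rw [fromCols_mul_fromRows, fromCols_mul_fromRows, ← hCD, hM, add_sub_cancel]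
  · rw [fromRows_mul_fromCols, fromRows_mul_fromCols, h1, h2, h, hB, fromRows_mul, hr _ hAM,
      hr _ hBM, mul_fromCols, hl _ hMA, hl _ hMB, hDC, fromBlocks_one, fromRows_zero, fromCols_zero,
      fromBlocks_one]
  · ext i j
    rfl
  · ext i j
    rfl

theorem mul_inc {ι α β : Type*} [Fintype α] [DecidableEq α] (M : Matrix ι α F) (f : β → α) :
    M * inc F f = M.submatrix id f := by
  ext i j
  simp [inc, mul_apply, one_apply]

theorem inc_transpose_mul_eq {ι α β : Type*} [Fintype α] [DecidableEq α] (M : Matrix α ι F)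
    (f : β → α) : (inc F f)ᵀ * M = M.submatrix f id := by
  ext i j
  simp [inc, mul_apply, one_apply]

theorem StdBlock.place_eq {m : ℕ} (U : StdBlock m) (X : Matrix (Fin U.a) (Fin U.b) F) :
    U.place X = inc F U.rowIdx * X * (inc F U.colIdx)ᵀ := by
  ext p q
  simp only [place, Matrix.sum_apply, mul_apply, inc, submatrix_apply, id, transpose_apply,
    one_apply, single_apply, Finset.sum_mul]
  rw [Finset.sum_comm]
  refine Finset.sum_congr rfl fun j _ => Finset.sum_congr rfl fun i _ => ?_
  simp only [eq_comm (a := p), eq_comm (a := q)]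
  split_ifs <;> simp_all

variable {V : Type*} [AddCommGroup V] [Module ℂ V] {m : ℕ}

/-- The bound `uRank χ₀ ρ ≤ k` for the standard subgroups implies `RankBound`, because every pair
`(A, B)` is conjugate to a standard block. -/
theorem rankBound_of_uRank_le {χ₀ : AddChar F ℂ} {ρ : Representation ℂ (GL (Fin m) F) V} {k : ℕ}
    (h : uRank χ₀ ρ ≤ k) : RankBound χ₀ (extendByZero ρ) k := by
  intro τ _ _ A A' B B' T v hBA hA hB hT hv hact
  obtain ⟨s, H, H', hH, hH', hHA, hHB⟩ := exists_adapted_basis hBA hA hB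
  set r := Fintype.card τ with hr
  let e : τ ≃ Fin r := Fintype.equivFin τ
  have hm : r + r + s = m := by
    have := square_of_invertible H H' hH hH'
    simpa using this.symm
  let U : StdBlock m := ⟨r, r, 0, r, by omega, by omega⟩
  let σ : (τ ⊕ τ) ⊕ Fin s ≃ Fin m :=
    ((((e.sumCongr e).trans finSumFinEquiv).sumCongr (Equiv.refl _)).trans finSumFinEquiv).trans
      (finCongr hm)
  have hσ₁ : σ.symm ∘ U.rowIdx = Sum.inl ∘ Sum.inl ∘ e.symm := by
    ext1 i
    rw [Function.comp_apply, Equiv.symm_apply_eq]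
    ext
    simp [σ, U, StdBlock.rowIdx]
  have hσ₂ : σ.symm ∘ U.colIdx = Sum.inl ∘ Sum.inr ∘ e.symm := by
    ext1 i
    rw [Function.comp_apply, Equiv.symm_apply_eq]
    ext
    simp [σ, U, StdBlock.colIdx, add_comm]
  set N : Matrix (Fin m) (Fin m) F := H.submatrix id σ.symm with hN
  set N' : Matrix (Fin m) (Fin m) F := H'.submatrix σ.symm id with hN'
  have hNN' : N * N' = 1 := by rw [hN, hN', submatrix_mul_equiv, hH, submatrix_id_id]
  have hN'N : N' * N = 1 := by
    rw [hN, hN', ← submatrix_mul _ _ _ _ _ Function.bijective_id, hH', submatrix_one_equiv]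
  have hNA : N * inc F U.rowIdx = A.submatrix id e.symm := by
    rw [mul_inc, hN, ← hHA, submatrix_submatrix, submatrix_submatrix, hσ₁]
    rfl
  have hNB : (inc F U.colIdx)ᵀ * N' = B.submatrix e.symm id := by
    rw [inc_transpose_mul_eq, hN', ← hHB, submatrix_submatrix, submatrix_submatrix, hσ₂]
    rfl
  have key (X : Matrix (Fin r) (Fin r) F) :
      (1 + U.place X) * N' = N' * (1 + A * X.submatrix e e * B) := by
    have h1 : A * X.submatrix e e * B = N * U.place X * N' := by
      rw [StdBlock.place_eq, Matrix.mul_assoc N, Matrix.mul_assoc _ _ N', hNB,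
        ← Matrix.mul_assoc N, ← Matrix.mul_assoc N, hNA]
      ext p q
      simp only [mul_apply, submatrix_apply, id]
      refine Fintype.sum_equiv e _ _ fun i => ?_
      rw [e.symm_apply_apply]
      congr 1
      refine Fintype.sum_equiv e _ _ fun j => ?_
      rw [e.symm_apply_apply]
    rw [h1, Matrix.add_mul, Matrix.mul_add, Matrix.mul_assoc N, ← Matrix.mul_assoc N', hN'N,
      Matrix.one_mul, Matrix.mul_one, Matrix.one_mul]
  have hap : CharAppears χ₀ ρ U (T.submatrix e.symm e.symm) := by
    refine ⟨extendByZero ρ N' v, fun h0 => hv ?_, fun X => ?_⟩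
    · have := congrArg (extendByZero ρ N) h0
      rwa [← map_mul_apply, hNN', map_one, map_zero] at this
    · rw [← extendByZero_coe]
      change extendByZero ρ (1 + U.place X) _ = _
      rw [← map_mul_apply, key, map_mul_apply, hact, map_smul]
      congr 2
      simp only [trace, diag_apply, mul_apply, submatrix_apply]
      refine Fintype.sum_equiv e _ _ fun i => Fintype.sum_equiv e _ _ fun j => ?_
      simp
  have hrank : (T.submatrix e.symm e.symm).rank = r := by
    rw [rank_submatrix, rank_of_isUnit _ ((isUnit_iff_isUnit_det _).2 hT)]
  calc r ≤ rankAt χ₀ ρ U := le_csSup (bddAbove_rankAt χ₀ ρ U) ⟨_, hap, hrank⟩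
    _ ≤ uRank χ₀ ρ := le_csSup (bddAbove_uRank χ₀ ρ) ⟨U, rfl⟩
    _ ≤ k := h

end URank

/-! ### Complete reducibility and tensor powers of the space of functions -/

section Decomposition

variable {G : Type*} [Group G] {V : Type*} [AddCommGroup V] [Module ℂ V]
  {ρ : Representation ℂ G V}

theorem isIrreducible_of_isAtom {τ : Subrepresentation ρ} (h : IsAtom τ) :
    τ.toRepresentation.IsIrreducible where
  exists_pair_ne := by
    refine ⟨⊥, ⊤, fun h0 => h.1 ?_⟩
    rw [eq_bot_iff]
    intro v hv
    have : (⟨v, hv⟩ : τ.toSubmodule) ∈ (⊥ : Subrepresentation τ.toRepresentation) := by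
      rw [h0]; trivial
    have h1 : (⟨v, hv⟩ : τ.toSubmodule) = 0 := this
    have h2 : v = 0 := congrArg Subtype.val h1
    rw [h2]
    exact zero_mem (⊥ : Submodule ℂ V)
  eq_bot_or_eq_top s := by
    let s' : Subrepresentation ρ :=
      { toSubmodule := s.toSubmodule.map τ.toSubmodule.subtype
        apply_mem_toSubmodule := by
          rintro g _ ⟨v, hv, rfl⟩
          exact ⟨τ.toRepresentation g v, s.apply_mem_toSubmodule g hv, rfl⟩ }
    have hs' : s' ≤ τ := by
      rintro _ ⟨v, -, rfl⟩
      exact v.2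
    rcases h.le_iff.1 hs' with h1 | h1
    · left
      rw [eq_bot_iff]
      intro v hv
      have h2 : (v : V) ∈ s' := ⟨v, hv, rfl⟩
      rw [h1] at h2
      have h3 : (v : V) = 0 := h2
      exact Subtype.ext h3
    · right
      rw [eq_top_iff]
      intro v _
      have h2 : (v : V) ∈ s' := by rw [h1]; exact v.2
      obtain ⟨u, hu, huv⟩ := h2
      rwa [Subtype.ext huv] at hu

theorem exists_isAtom_le [FiniteDimensional ℂ V] {σ : Subrepresentation ρ} (h : σ ≠ ⊥) :
    ∃ τ ≤ σ, IsAtom τ := by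
  obtain ⟨τ, ⟨h1, h2⟩, hmin⟩ := exists_minimalFor_of_wellFoundedLT
    (fun τ : Subrepresentation ρ => τ ≠ ⊥ ∧ τ ≤ σ)
    (fun τ => Module.finrank ℂ τ.toSubmodule) ⟨σ, h, le_rfl⟩
  refine ⟨τ, h2, h1, fun s hs => ?_⟩
  by_contra h3
  have h4 := hmin ⟨h3, hs.le.trans h2⟩
  have h5 : s.toSubmodule < τ.toSubmodule := hs
  exact absurd (Submodule.finrank_lt_finrank_of_lt h5) (not_lt.2 (h4 (Submodule.finrank_mono h5.le)))

/-- The inclusion of a subrepresentation as an intertwining map. -/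
def inclusion (τ : Subrepresentation ρ) : τ.toRepresentation.IntertwiningMap ρ :=
  LinearMap.intertwiningMap_of_isIntertwiningMap _ _ τ.toSubmodule.subtype fun _ _ => rfl

theorem inclusion_apply (τ : Subrepresentation ρ) (v : τ.toSubmodule) : inclusion τ v = v :=
  rfl

/-- Maschke's theorem: an equivariant projection to a subrepresentation. -/
theorem exists_equivariant_projection [Finite G] (τ : Subrepresentation ρ) :
    ∃ p : ρ.IntertwiningMap τ.toRepresentation, ∀ v : τ.toSubmodule, p (v : V) = v := by
  obtain ⟨q, hq⟩ := exists_isCompl τ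
  have hc : IsCompl τ.toSubmodule q.toSubmodule := by
    rw [isCompl_iff, disjoint_iff, codisjoint_iff] at hq ⊢
    rw [← Subrepresentation.toSubmodule_inf, ← Subrepresentation.toSubmodule_sup, hq.1, hq.2]
    exact ⟨rfl, rfl⟩
  refine ⟨LinearMap.intertwiningMap_of_isIntertwiningMap _ _
    (Submodule.projectionOnto _ _ hc) fun g v => ?_, fun v => ?_⟩
  · obtain ⟨x, hx, y, hy, rfl⟩ : ∃ x ∈ τ.toSubmodule, ∃ y ∈ q.toSubmodule, x + y = v :=
      Submodule.mem_sup.1 (by rw [hc.sup_eq_top]; trivial)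
    have h1 := Submodule.projectionOnto_apply_left hc ⟨x, hx⟩
    have h2 := Submodule.projectionOnto_apply_right hc ⟨y, hy⟩
    have h3 := Submodule.projectionOnto_apply_left hc ⟨ρ g x, τ.apply_mem_toSubmodule g hx⟩
    have h4 := Submodule.projectionOnto_apply_right hc ⟨ρ g y, q.apply_mem_toSubmodule g hy⟩
    dsimp only at h1 h2 h3 h4
    rw [map_add, map_add, map_add, h1, h2, h3, h4, add_zero, add_zero]
    rfl
  · exact Submodule.projectionOnto_apply_left hc v

/-- Complete reducibility, in the form of equivariant projections to irreducible
subrepresentations adding up to the identity. -/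
theorem exists_decomposition [Finite G] [FiniteDimensional ℂ V] (ρ : Representation ℂ G V) :
    ∃ (N : ℕ) (τ : Fin N → Subrepresentation ρ)
      (p : ∀ j, ρ.IntertwiningMap (τ j).toRepresentation),
      (∀ j, (τ j).toRepresentation.IsIrreducible) ∧ ∀ v, ∑ j, (p j v : V) = v := by
  suffices H : ∀ (d : ℕ) (σ : Subrepresentation ρ), Module.finrank ℂ σ.toSubmodule ≤ d →
      ∃ (N : ℕ) (c : Fin N → Σ τ : Subrepresentation ρ, ρ.IntertwiningMap τ.toRepresentation),
        (∀ j, (c j).1.toRepresentation.IsIrreducible) ∧ ∀ v ∈ σ, ∑ j, ((c j).2 v : V) = v by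
    obtain ⟨N, c, h1, h2⟩ := H _ ⊤ le_rfl
    exact ⟨N, fun j => (c j).1, fun j => (c j).2, h1, fun v => h2 v trivial⟩
  intro d
  induction d with
  | zero =>
    intro σ hσ
    refine ⟨0, Fin.elim0, fun j => j.elim0, fun v hv => ?_⟩
    have h1 : σ.toSubmodule = ⊥ := Submodule.finrank_eq_zero.1 (Nat.le_zero.1 hσ)
    have h2 : v ∈ σ.toSubmodule := hv
    rw [h1, Submodule.mem_bot] at h2
    simp [h2]
  | succ d ih =>
    intro σ hσ
    by_cases hbot : σ = ⊥
    · refine ⟨0, Fin.elim0, fun j => j.elim0, fun v hv => ?_⟩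
      rw [hbot] at hv
      have h2 : v = 0 := hv
      simp [h2]
    obtain ⟨τ, hτ, hat⟩ := exists_isAtom_le hbot
    obtain ⟨P, hP⟩ := exists_equivariant_projection τ
    -- The part of `σ` complementary to `τ`.
    have hlt : (σ ⊓ P.ker).toSubmodule < σ.toSubmodule := by
      refine lt_of_le_of_ne (fun v hv => hv.1) fun h0 => hat.1 ?_
      rw [eq_bot_iff]
      intro v hv
      have h1 : v ∈ (σ ⊓ P.ker).toSubmodule := by rw [h0]; exact hτ hv
      have h2 : P v = 0 := h1.2
      have h3 := hP ⟨v, hv⟩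
      rw [h2] at h3
      have h4 : v = 0 := (congrArg Subtype.val h3).symm
      rw [h4]
      exact zero_mem (⊥ : Submodule ℂ V)
    obtain ⟨N, c, h1, h2⟩ := ih (σ ⊓ P.ker)
      (by have := Submodule.finrank_lt_finrank_of_lt hlt; omega)
    let Q : ρ.IntertwiningMap ρ := .id ρ - (inclusion τ).comp P
    refine ⟨N + 1, Fin.cons ⟨τ, P⟩ fun j => ⟨(c j).1, (c j).2.comp Q⟩, ?_, fun v hv => ?_⟩
    · exact Fin.cases (isIrreducible_of_isAtom hat) h1
    · have h3 : v - P v ∈ σ ⊓ P.ker := by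
        refine ⟨σ.toSubmodule.sub_mem hv (hτ (P v).2), ?_⟩
        change P (v - P v) = 0
        rw [map_sub, hP, sub_self]
      have h4 := h2 _ h3
      rw [Fin.sum_univ_succ]
      change (P v : V) + ∑ j, ((c j).2 (v - P v) : V) = v
      rw [h4, add_sub_cancel]

end Decomposition

section TensorPower

variable {F : Type*} [Field F] {n k : ℕ}

variable (F n k) in
/-- The permutation representation of `GL n` on the functions of `k` vectors in `F^n`. -/
def permFun : Representation ℂ (GL (Fin n) F) ((Fin k → Fin n → F) → ℂ) where
  toFun g := LinearMap.funLeft ℂ ℂ fun y i => (g⁻¹ : GL (Fin n) F).val *ᵥ y i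
  map_one' := by ext f y; simp [LinearMap.funLeft]
  map_mul' g h := by
    refine LinearMap.ext fun f => funext fun y => ?_
    simp only [LinearMap.funLeft_apply, Module.End.mul_apply, _root_.mul_inv_rev, Units.val_mul,
      Matrix.mulVec_mulVec]

theorem permFun_apply (g : GL (Fin n) F) (f : (Fin k → Fin n → F) → ℂ) (y : Fin k → Fin n → F) :
    permFun F n k g f y = f fun i => (g⁻¹ : GL (Fin n) F).val *ᵥ y i :=
  rfl

/-- A tensor product of functions of one variable, as a function of several variables. -/
noncomputable def tensorToFun (X : Type*) (k : ℕ) :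
    PiTensorProduct ℂ (fun _ : Fin k => X → ℂ) →ₗ[ℂ] ((Fin k → X) → ℂ) :=
  PiTensorProduct.lift
    { toFun f y := ∏ i, f i (y i)
      map_update_add' f i u v := by
        ext y
        simp only [Pi.add_apply, ← Finset.prod_erase_mul _ _ (Finset.mem_univ i),
          Function.update_self, mul_add]
        congr 2 <;> refine Finset.prod_congr rfl fun j hj => ?_ <;>
          simp [Function.update_of_ne (Finset.ne_of_mem_erase hj)]
      map_update_smul' f i c u := by
        ext y
        simp only [Pi.smul_apply, ← Finset.prod_erase_mul _ _ (Finset.mem_univ i),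
          Function.update_self, smul_eq_mul, mul_left_comm _ c]
        congr 2
        refine Finset.prod_congr rfl fun j hj => ?_
        simp [Function.update_of_ne (Finset.ne_of_mem_erase hj)] }

theorem tensorToFun_tprod {X : Type*} (f : Fin k → X → ℂ) (y : Fin k → X) :
    tensorToFun X k (PiTensorProduct.tprod ℂ f) y = ∏ i, f i (y i) := by
  simp [tensorToFun]

/-- Functions of several variables are tensor products of functions of one variable. -/
noncomputable def tensorEquivFun (X : Type*) [Fintype X] [DecidableEq X] (k : ℕ) :
    PiTensorProduct ℂ (fun _ : Fin k => X → ℂ) ≃ₗ[ℂ] ((Fin k → X) → ℂ) :=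
  LinearEquiv.ofLinearMap (tensorToFun X k)
    (∑ y : Fin k → X, (LinearMap.proj y).smulRight
      (PiTensorProduct.tprod ℂ fun i => (Pi.single (y i) 1 : X → ℂ)))
    (by
      refine LinearMap.ext fun φ => funext fun z => ?_
      simp only [LinearMap.comp_apply, LinearMap.sum_apply, LinearMap.smulRight_apply,
        LinearMap.proj_apply, map_sum, map_smul, Finset.sum_apply, Pi.smul_apply,
        tensorToFun_tprod, LinearMap.id_apply, smul_eq_mul]
      rw [Finset.sum_eq_single z]
      · simp
      · intro y _ hy
        obtain ⟨i, hi⟩ := Function.ne_iff.1 hy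
        rw [Finset.prod_eq_zero (Finset.mem_univ i) (Pi.single_eq_of_ne hi.symm _), mul_zero]
      · simp)
    (by
      refine PiTensorProduct.ext (MultilinearMap.ext fun f => ?_)
      simp only [LinearMap.compMultilinearMap_apply, LinearMap.comp_apply, LinearMap.sum_apply,
        LinearMap.smulRight_apply, LinearMap.proj_apply, tensorToFun_tprod, LinearMap.id_apply]
      have h (i : Fin k) : f i = ∑ x, f i x • (Pi.single x 1 : X → ℂ) := by
        ext x
        simp [Pi.single_apply]
      conv_rhs => rw [funext h, MultilinearMap.map_sum]
      refine Finset.sum_congr rfl fun y _ => ?_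
      rw [MultilinearMap.map_smul_univ])

theorem tensorProd_apply_tprod {G : Type*} [Group G] {V : Fin k → Type*}
    [∀ i, AddCommGroup (V i)] [∀ i, Module ℂ (V i)] (τ : ∀ i, Representation ℂ G (V i)) (g : G)
    (v : ∀ i, V i) : tensorProd τ g (PiTensorProduct.tprod ℂ v) =
      PiTensorProduct.tprod ℂ fun i => τ i g (v i) :=
  PiTensorProduct.map_tprod _ _

/-- Intertwining maps of the factors induce an intertwining map of tensor products. -/
noncomputable def tensorMap {G : Type*} [Group G] {V W : Fin k → Type*}
    [∀ i, AddCommGroup (V i)] [∀ i, Module ℂ (V i)] [∀ i, AddCommGroup (W i)]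
    [∀ i, Module ℂ (W i)] {τ : ∀ i, Representation ℂ G (V i)} {σ : ∀ i, Representation ℂ G (W i)}
    (f : ∀ i, (τ i).IntertwiningMap (σ i)) : (tensorProd τ).IntertwiningMap (tensorProd σ) where
  toLinearMap := PiTensorProduct.map fun i => (f i).toLinearMap
  isIntertwining' g := by
    refine PiTensorProduct.ext (MultilinearMap.ext fun v => ?_)
    simp [tensorProd_apply_tprod, (f _).isIntertwining]

theorem tensorMap_tprod {G : Type*} [Group G] {V W : Fin k → Type*}
    [∀ i, AddCommGroup (V i)] [∀ i, Module ℂ (V i)] [∀ i, AddCommGroup (W i)]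
    [∀ i, Module ℂ (W i)] {τ : ∀ i, Representation ℂ G (V i)} {σ : ∀ i, Representation ℂ G (W i)}
    (f : ∀ i, (τ i).IntertwiningMap (σ i)) (v : ∀ i, V i) :
    tensorMap f (PiTensorProduct.tprod ℂ v) = PiTensorProduct.tprod ℂ fun i => f i (v i) :=
  PiTensorProduct.map_tprod _ _

variable [Fintype F] [DecidableEq F]

theorem tensorEquivFun_equivariant (g : GL (Fin n) F)
    (x : PiTensorProduct ℂ fun _ : Fin k => (Fin n → F) → ℂ) :
    tensorEquivFun (Fin n → F) k (tensorProd (fun _ : Fin k => permRep F n) g x) =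
      permFun F n k g (tensorEquivFun (Fin n → F) k x) := by
  have : (tensorEquivFun (Fin n → F) k).toLinearMap ∘ₗ tensorProd (fun _ : Fin k => permRep F n) g =
      permFun F n k g ∘ₗ (tensorEquivFun (Fin n → F) k).toLinearMap := by
    refine PiTensorProduct.ext (MultilinearMap.ext fun f => funext fun y => ?_)
    change tensorToFun (Fin n → F) k
        (tensorProd (fun _ : Fin k => permRep F n) g (PiTensorProduct.tprod ℂ f)) y =
      tensorToFun (Fin n → F) k (PiTensorProduct.tprod ℂ f)
        fun i => (g⁻¹ : GL (Fin n) F).val *ᵥ y i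
    rw [tensorProd_apply_tprod, tensorToFun_tprod, tensorToFun_tprod]
    rfl
  exact LinearMap.congr_fun this x

end TensorPower

section Twist

variable {G : Type*} [Group G] {V W : Type*} [AddCommGroup V] [Module ℂ V] [AddCommGroup W]
  [Module ℂ W] {ρ : Representation ℂ G V} {σ : Representation ℂ G W}

theorem twist_apply (χ : G →* ℂˣ) (ρ : Representation ℂ G V) (g : G) (v : V) :
    twist χ ρ g v = (χ g : ℂ) • ρ g v :=
  rfl

/-- An intertwining map is also one of the twisted representations. -/
def twistMap (χ : G →* ℂˣ) (f : ρ.IntertwiningMap σ) : (twist χ ρ).IntertwiningMap (twist χ σ) :=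
  LinearMap.intertwiningMap_of_isIntertwiningMap _ _ f.toLinearMap fun g v => by
    simp [twist_apply, f.isIntertwining]

end Twist

section TensorRank

variable {F : Type*} [Field F] [Finite F] {n k : ℕ} {V : Type*} [AddCommGroup V] [Module ℂ V]

/-- The tensor rank of `ν` is at most `k` if `ν` embeds in a twist of the space of functions of `k`
vectors. -/
theorem irrTensorRankLE_of_permFun {ν : Representation ℂ (GL (Fin n) F) V} (hν : ν.IsIrreducible)
    (χ : GL (Fin n) F →* ℂˣ) (f : ν.IntertwiningMap (twist χ (permFun F n k))) (hf : f ≠ 0) :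
    IrrTensorRankLE ν k := by
  classical
  have := Fintype.ofFinite F
  let e := tensorEquivFun (Fin n → F) k
  obtain ⟨N, τ, p, hτ, hp⟩ := exists_decomposition (permRep F n)
  let E : (permFun F n k).IntertwiningMap (tensorProd fun _ : Fin k => permRep F n) :=
    LinearMap.intertwiningMap_of_isIntertwiningMap _ _ e.symm.toLinearMap fun g y => by
      change e.symm _ = tensorProd _ g (e.symm y)
      rw [LinearEquiv.symm_apply_eq, tensorEquivFun_equivariant, LinearEquiv.apply_symm_apply]
  obtain ⟨v, hv⟩ : ∃ v, f v ≠ 0 := by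
    by_contra! h
    exact hf (Representation.IntertwiningMap.ext (LinearMap.ext h))
  have hE : E (f v) ≠ 0 := fun h => hv (e.symm.map_eq_zero_iff.1 h)
  -- The tensor product is the sum over all choices of an irreducible component in each factor.
  have hsum (x : PiTensorProduct ℂ fun _ : Fin k => (Fin n → F) → ℂ) :
      ∑ s : Fin k → Fin N,
        tensorMap (fun i => inclusion (τ (s i))) (tensorMap (fun i => p (s i)) x) = x := by
    induction x using PiTensorProduct.induction_on with
    | smul_tprod r f =>
      simp only [map_smul, tensorMap_tprod, inclusion_apply, ← Finset.smul_sum]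
      have h := MultilinearMap.map_sum
        (PiTensorProduct.tprod ℂ (s := fun _ : Fin k => (Fin n → F) → ℂ))
        (fun i j => (p j (f i) : (Fin n → F) → ℂ))
      simp only [hp] at h
      rw [← h]
    | add x y hx hy => simp only [map_add, Finset.sum_add_distrib, hx, hy]
  obtain ⟨s, hs⟩ : ∃ s : Fin k → Fin N, tensorMap (fun i => p (s i)) (E (f v)) ≠ 0 := by
    by_contra! h
    apply hE
    rw [← hsum (E (f v))]
    simp [h]
  let Φ := (twistMap χ (tensorMap fun i => p (s i))).comp ((twistMap χ E).comp f)
  refine ⟨k, le_rfl, χ, fun i => τ (s i), fun i => hτ _, Φ, ?_⟩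
  refine (hν.injective_or_eq_zero Φ).resolve_right fun h => hs ?_
  exact congrArg (fun Ψ : ν.IntertwiningMap _ => Ψ v) h

/-- A tensor product of `ℓ ≤ k` components of `L²(F^n)` embeds in the space of functions of `k`
vectors. -/
theorem exists_permFun_of_irrTensorRankLE {ν : Representation ℂ (GL (Fin n) F) V}
    (h : IrrTensorRankLE ν k) : ∃ (χ : GL (Fin n) F →* ℂˣ)
      (f : ν.IntertwiningMap (twist χ (permFun F n k))), Function.Injective f := by
  classical
  have := Fintype.ofFinite F
  obtain ⟨l, hl, χ, τ, -, f, hf⟩ := h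
  let e := tensorEquivFun (Fin n → F) l
  let E : (tensorProd fun _ : Fin l => permRep F n).IntertwiningMap (permFun F n l) :=
    LinearMap.intertwiningMap_of_isIntertwiningMap _ _ e.toLinearMap tensorEquivFun_equivariant
  have hE : Function.Injective E := e.injective
  let I := tensorMap fun i => inclusion (τ i)
  have hI : Function.Injective I := by
    choose r hr using fun i => (τ i).toSubmodule.subtype.exists_leftInverse_of_injective
      (Submodule.ker_subtype _)
    have h1 : PiTensorProduct.map r ∘ₗ I.toLinearMap = LinearMap.id := by
      refine (PiTensorProduct.map_comp _ _).symm.trans ?_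
      rw [← PiTensorProduct.map_id]
      congr 1
      exact funext hr
    exact Function.LeftInverse.injective (LinearMap.congr_fun h1)
  let P : (permFun F n l).IntertwiningMap (permFun F n k) :=
    LinearMap.intertwiningMap_of_isIntertwiningMap _ _
      (LinearMap.funLeft ℂ ℂ fun y i => y (Fin.castLE hl i)) fun g φ => rfl
  have hP : Function.Injective P := by
    apply LinearMap.funLeft_injective_of_surjective
    intro y
    refine ⟨fun i => if h : (i : ℕ) < l then y ⟨i, h⟩ else 0, ?_⟩
    ext i
    simp
  exact ⟨χ, (twistMap χ P).comp ((twistMap χ E).comp ((twistMap χ I).comp f)),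
    hP.comp (hE.comp (hI.comp hf))⟩

end TensorRank

/-! ### Frobenius reciprocity, and the bound on the tensor rank -/

section FrobeniusReciprocity

variable {F : Type*} [Field F]

instance finite_units_char [Finite F] : Finite (Fˣ →* ℂˣ) := by
  have := Fintype.ofFinite F
  obtain ⟨e⟩ := CommGroup.monoidHom_mulEquiv_of_hasEnoughRootsOfUnity Fˣ ℂ
  exact Finite.of_equiv _ e.symm.toEquiv

/-- Orthogonality of the multiplicative characters of a finite field. -/
theorem sum_units_char [Finite F] [DecidableEq F] [Fintype (Fˣ →* ℂˣ)] (a : Fˣ) :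
    ∑ χ : Fˣ →* ℂˣ, (χ a : ℂ) = if a = 1 then (Fintype.card (Fˣ →* ℂˣ) : ℂ) else 0 := by
  have := Fintype.ofFinite F
  split_ifs with h
  · simp [h]
  · obtain ⟨ψ, hψ⟩ := CommGroup.exists_apply_ne_one_of_hasEnoughRootsOfUnity Fˣ ℂ h
    have hψ' : (ψ a : ℂ) ≠ 1 := by simpa using hψ
    refine eq_zero_of_mul_eq_self_left hψ' ?_
    rw [Finset.mul_sum]
    exact Fintype.sum_equiv (Equiv.mulLeft ψ) _ _ fun χ => by simp

variable [Finite F] {n k : ℕ} {V : Type*} [AddCommGroup V] [Module ℂ V]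

/-- Frobenius reciprocity: a functional invariant under the elements of determinant one fixing the
vectors `y₀` gives intertwining maps to twists of the functions on the orbit of `y₀`, and the
vectors on which the functional does not vanish are not annihilated by all of them. -/
theorem exists_permFun_of_functional (π : Representation ℂ (GL (Fin n) F) V)
    (y₀ : Fin k → Fin n → F) (l : V →ₗ[ℂ] ℂ) {w : V} (hw : l w ≠ 0)
    (hl : ∀ g : GL (Fin n) F, g.val.det = 1 → (∀ i, g.val *ᵥ y₀ i = y₀ i) → ∀ u, l (π g u) = l u) :
    ∃ (χ : GL (Fin n) F →* ℂˣ) (f : π.IntertwiningMap (twist χ (permFun F n k))), f w ≠ 0 := by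
  classical
  have := Fintype.ofFinite F
  have := Fintype.ofFinite (Fˣ →* ℂˣ)
  have := Fintype.ofFinite (GL (Fin n) F)
  let D (χ : Fˣ →* ℂˣ) : GL (Fin n) F →* ℂˣ := χ.comp GeneralLinearGroup.det
  let φ (χ : Fˣ →* ℂˣ) : V →ₗ[ℂ] ((Fin k → Fin n → F) → ℂ) :=
    LinearMap.pi fun y => ∑ g : GL (Fin n) F with ∀ i, g.val *ᵥ y₀ i = y i,
      (D χ g : ℂ) • l ∘ₗ π g⁻¹
  have hφ (χ : Fˣ →* ℂˣ) (u : V) (y : Fin k → Fin n → F) :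
      φ χ u y = ∑ g : GL (Fin n) F with ∀ i, g.val *ᵥ y₀ i = y i, (D χ g : ℂ) * l (π g⁻¹ u) := by
    simp [φ, LinearMap.sum_apply]
  let f (χ : Fˣ →* ℂˣ) : π.IntertwiningMap (twist (D χ) (permFun F n k)) :=
    LinearMap.intertwiningMap_of_isIntertwiningMap _ _ (φ χ) fun h u => by
      ext y
      rw [twist_apply, Pi.smul_apply, permFun_apply, hφ, hφ, smul_eq_mul, Finset.mul_sum]
      refine Finset.sum_bij' (fun g _ => h⁻¹ * g) (fun g _ => h * g) ?_ ?_ ?_ ?_ ?_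
      · intro g hg
        simp only [Finset.mem_filter, Finset.mem_univ, true_and] at hg ⊢
        intro i
        rw [Units.val_mul, ← mulVec_mulVec, hg]
      · intro g hg
        simp only [Finset.mem_filter, Finset.mem_univ, true_and] at hg ⊢
        intro i
        rw [Units.val_mul, ← mulVec_mulVec, hg, mulVec_mulVec, ← Units.val_mul]
        simp
      · intro g _
        exact mul_inv_cancel_left h g
      · intro g _
        exact inv_mul_cancel_left h g
      · intro g _
        have h1 : π (h⁻¹ * g)⁻¹ u = π g⁻¹ (π h u) := by
          rw [_root_.mul_inv_rev, inv_inv, map_mul]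
          rfl
        rw [h1, ← mul_assoc, ← Units.val_mul, ← map_mul, mul_inv_cancel_left]
  suffices h : ∃ χ, f χ w ≠ 0 by
    obtain ⟨χ, hχ⟩ := h
    exact ⟨D χ, f χ, hχ⟩
  by_contra! h
  -- Summation over all characters singles out the elements of determinant one.
  have h1 : ∑ χ : Fˣ →* ℂˣ, φ χ w y₀ = 0 :=
    Finset.sum_eq_zero fun χ _ => congrFun (h χ) y₀
  simp_rw [hφ] at h1
  rw [Finset.sum_comm] at h1
  have h2 (g : GL (Fin n) F) (hg : g ∈ Finset.univ.filter fun g : GL (Fin n) F =>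
      ∀ i, g.val *ᵥ y₀ i = y₀ i) : ∑ χ : Fˣ →* ℂˣ, (D χ g : ℂ) * l (π g⁻¹ w) =
        if g.det = 1 then (Fintype.card (Fˣ →* ℂˣ) : ℂ) * l w else 0 := by
    rw [← Finset.sum_mul]
    change (∑ χ : Fˣ →* ℂˣ, (χ g.det : ℂ)) * _ = _
    rw [sum_units_char]
    simp only [Finset.mem_filter, Finset.mem_univ, true_and] at hg
    split_ifs with hd
    · congr 1
      have hd' : g.val.det = 1 := congrArg Units.val hd
      rw [← hl g hd' hg (π g⁻¹ w), ← Module.End.mul_apply, ← map_mul, mul_inv_cancel, map_one,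
        Module.End.one_apply]
    · rw [zero_mul]
  rw [Finset.sum_congr rfl h2, ← Finset.sum_filter, Finset.sum_const, nsmul_eq_mul] at h1
  refine mul_ne_zero ?_ (mul_ne_zero (by simp) hw) h1
  rw [Nat.cast_ne_zero, Finset.card_ne_zero]
  exact ⟨1, by simp⟩

end FrobeniusReciprocity

section Descent

variable {F : Type*} [Field F] {n : ℕ}

/-- The decomposition of the indices of `GL m` into those of `GL n` and the remaining ones. -/
def blockIdx {m : ℕ} (h : n ≤ m) : Fin n ⊕ Fin (m - n) ≃ Fin m :=
  finSumFinEquiv.trans (finCongr (Nat.add_sub_of_le h))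

theorem blockEmb_eq_emb {m : ℕ} (h : n ≤ m) (g : GL (Fin n) F) :
    (blockEmb F h g).val =
      emb (inc F (blockIdx h ∘ Sum.inl)) (inc F (blockIdx h ∘ Sum.inl))ᵀ g.val := by
  ext p q
  obtain ⟨p, rfl⟩ := (blockIdx h).surjective p
  obtain ⟨q, rfl⟩ := (blockIdx h).surjective q
  change fromBlocks g.val 0 0 1 ((blockIdx h).symm (blockIdx h p))
    ((blockIdx h).symm (blockIdx h q)) = _
  rw [Equiv.symm_apply_apply, Equiv.symm_apply_apply, emb, Matrix.mul_assoc]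
  rcases p with p | p <;> rcases q with q | q <;>
    simp [inc, mul_apply, one_apply, Finset.sum_ite_eq]

theorem frame_blockIdx {m : ℕ} (h : n ≤ m) :
    Frame (inc F (blockIdx h ∘ Sum.inl)) (inc F (blockIdx h ∘ Sum.inl))ᵀ
      (inc F (blockIdx h ∘ Sum.inr)) (inc F (blockIdx h ∘ Sum.inr))ᵀ where
  aa := inc_transpose_mul_self ((blockIdx h).injective.comp Sum.inl_injective)
  cc := inc_transpose_mul_self ((blockIdx h).injective.comp Sum.inr_injective)
  ac := inc_transpose_mul_of_disjoint fun i j => by simp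
  ca := inc_transpose_mul_of_disjoint fun i j => by simp

variable [Finite F] {V : Type*} [AddCommGroup V] [Module ℂ V]

/-- Small asymptotic rank implies small tensor rank. -/
theorem tensorRankLE_of_asymptoticRankLE {χ₀ : AddChar F ℂ} (hχ₀ : χ₀ ≠ 1)
    {π : Representation ℂ (GL (Fin n) F) V} {k : ℕ} (h : AsymptoticRankLE χ₀ π k) :
    TensorRankLE π k := by
  classical
  have := Fintype.ofFinite F
  obtain ⟨M, hM⟩ := h
  intro ν hν
  obtain ⟨m, hm, hm'⟩ : ∃ m, M ≤ m ∧ n + (n * (2 * n) + n + 2 * k) ≤ m :=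
    ⟨_, le_max_left _ _, le_max_right _ _⟩
  obtain ⟨hnm, W, _, _, _, ρ, -, hρ, f, hf⟩ := hM m hm
  obtain ⟨s, hs⟩ := hν.exists_pair_ne
  obtain ⟨x, hx⟩ : ∃ x : ν.toSubmodule, x ≠ 0 := by
    by_contra! h0
    have : Subsingleton ν.toSubmodule := ⟨fun x y => by rw [h0 x, h0 y]⟩
    obtain ⟨s', hs⟩ := hs
    exact hs (Subrepresentation.toSubmodule_injective (Subsingleton.elim _ _))
  let f' : ν.toRepresentation.IntertwiningMap (ρ.comp (blockEmb F hnm)) := f.comp (inclusion ν)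
  have hfx : f' x ≠ 0 := fun h0 => hx (Subtype.ext (hf (h0.trans (map_zero f).symm)))
  obtain ⟨σ, _, S, l, hσ, hl, hinv⟩ := detected hχ₀ k (frame_blockIdx (F := F) hnm)
    (rankBound_of_uRank_le hρ) (by simp only [Fintype.card_fin]; omega) hfx
  obtain ⟨e⟩ : Nonempty (σ ↪ Fin k) := Function.Embedding.nonempty_of_card_le (by simpa using hσ)
  let y₀ : Fin k → Fin n → F := fun i j => if h : ∃ t, e t = i then S j h.choose else 0
  have hy₀ (t : σ) : y₀ (e t) = fun j => S j t := by
    ext j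
    have h1 : ∃ t', e t' = e t := ⟨t, rfl⟩
    simp only [y₀, dif_pos h1]
    rw [e.injective h1.choose_spec]
  obtain ⟨χ, φ, hφ⟩ := exists_permFun_of_functional ν.toRepresentation y₀ (l ∘ₗ f'.toLinearMap)
    (w := x) hl fun g hg hgy u => by
      change l (f' (ν.toRepresentation g u)) = l (f' u)
      rw [f'.isIntertwining, ← hinv g.val hg ?_ (f' u)]
      · rw [← blockEmb_eq_emb, extendByZero_coe]
        rfl
      · ext j t
        have := congrFun (hgy (e t)) j
        rw [hy₀] at this
        exact this
  exact irrTensorRankLE_of_permFun hν χ φ fun h0 => hφ (by rw [h0]; rfl)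

end Descent

/-! ### Characters, function spaces, and the bound on the asymptotic rank -/

section Characters

variable {F : Type*} [Field F] {n : ℕ}

theorem exists_transvection_unit {i j : Fin n} (h : i ≠ j) (c : F) :
    ∃ g : GL (Fin n) F, g.val = transvection i j c :=
  ⟨GeneralLinearGroup.mkOfDetNeZero (transvection i j c) (by simp [det_transvection_of_ne _ _ h]),
    rfl⟩

/-- The diagonal matrices with entries `1`, except at the index `i`. -/
def diagUnit (i : Fin n) : Fˣ →* GL (Fin n) F :=
  Units.map ((diagonalRingHom (Fin n) F).toMonoidHom.comp (MonoidHom.mulSingle (fun _ => F) i))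

theorem diagUnit_val (i : Fin n) (u : Fˣ) :
    (diagUnit i u).val = diagonal (Pi.mulSingle i (u : F)) :=
  rfl

theorem det_diagUnit (i : Fin n) (u : Fˣ) : (diagUnit i u).det = u := by
  ext
  change (diagUnit i u).val.det = u
  rw [diagUnit_val, det_diagonal, Finset.prod_eq_single i]
  · simp
  · intro j _ hj
    simp [hj]
  · simp

/-- Root groups are in the commutator subgroup, with the single exception of `GL 2` over the field
of two elements. -/
theorem char_transvection_eq_one (hnF : ¬(n = 2 ∧ Nat.card F = 2)) (χ : GL (Fin n) F →* ℂˣ)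
    {i j : Fin n} (h : i ≠ j) (c : F) (g : GL (Fin n) F) (hg : g.val = transvection i j c) :
    χ g = 1 := by
  -- With a scalar `u ≠ 0, 1` take a commutator with a diagonal matrix, otherwise one of two
  -- transvections through a third index.
  by_cases hu : ∃ u : F, u ≠ 0 ∧ u ≠ 1
  · obtain ⟨u, hu0, hu1⟩ := hu
    obtain ⟨t, ht⟩ := exists_transvection_unit h (c / (u - 1))
    have h1 : diagUnit i (Units.mk0 u hu0) * t = g * t * diagUnit i (Units.mk0 u hu0) := by
      ext1
      simp only [Units.val_mul, diagUnit_val, ht, hg]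
      rw [transvection_mul_transvection_same _ _ h]
      have h2 : c + c / (u - 1) = u * (c / (u - 1)) := by
        have := sub_ne_zero.2 hu1
        field_simp
        ring
      rw [h2]
      simp only [transvection, Matrix.mul_add, Matrix.add_mul, Matrix.mul_one, Matrix.one_mul,
        Units.val_mk0]
      congr 1
      ext p q
      simp only [diagonal_mul, mul_diagonal, single_apply]
      split_ifs with hpq
      · obtain ⟨rfl, rfl⟩ := hpq
        simp [h.symm]
      · simp
    have h2 := congrArg χ h1
    simp only [map_mul] at h2
    rw [mul_comm, mul_assoc] at h2
    exact (mul_eq_right.1 h2.symm)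
  · have hF : Nat.card F = 2 := by
      rw [Nat.card_eq_two_iff]
      refine ⟨0, 1, zero_ne_one, ?_⟩
      ext u
      by_contra h0
      exact hu ⟨u, fun h1 => h0 (by simp [h1]), fun h1 => h0 (by simp [h1])⟩
    obtain ⟨k, hki, hkj⟩ : ∃ k : Fin n, k ≠ i ∧ k ≠ j := by
      have h2 := Finset.card_le_two (a := i) (b := j)
      obtain ⟨k, hk⟩ : ∃ k, k ∉ ({i, j} : Finset (Fin n)) := by
        by_contra! h3
        have h4 : ({i, j} : Finset (Fin n)) = Finset.univ := Finset.eq_univ_iff_forall.2 h3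
        have h5 := Finset.card_pair h
        rw [h4, Finset.card_univ, Fintype.card_fin] at h5
        exact hnF ⟨h5, hF⟩
      simp only [Finset.mem_insert, Finset.mem_singleton, not_or] at hk
      exact ⟨k, hk⟩
    obtain ⟨s, hs⟩ := exists_transvection_unit hki.symm c
    obtain ⟨t, ht⟩ := exists_transvection_unit hkj (1 : F)
    have h1 : s * t = g * (t * s) := by
      ext1
      simp only [Units.val_mul, hs, ht, hg, transvection, Matrix.mul_add, Matrix.add_mul,
        Matrix.one_mul, single_mul_single_same, mul_one,
        single_mul_single_of_ne _ _ _ _ h.symm, single_mul_single_of_ne _ _ _ _ hkj.symm]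
      simp only [Matrix.mul_zero, add_zero]
      abel
    have h2 := congrArg χ h1
    simp only [map_mul] at h2
    rw [mul_comm (χ t)] at h2
    exact mul_eq_right.1 h2.symm

theorem char_eq_one_of_det (hnF : ¬(n = 2 ∧ Nat.card F = 2)) (χ : GL (Fin n) F →* ℂˣ)
    (g : GL (Fin n) F) (hg : g.val.det = 1) : χ g = 1 := by
  have key : ∃ g' : GL (Fin n) F, g'.val = g.val ∧ χ g' = 1 := by
    refine Submonoid.closure_induction
      (motive := fun M _ => ∃ g' : GL (Fin n) F, g'.val = M ∧ χ g' = 1) ?_ ?_ ?_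
      (mem_closure_transvection hg)
    · rintro _ ⟨i, j, c, hij, rfl⟩
      obtain ⟨t, ht⟩ := exists_transvection_unit hij c
      exact ⟨t, ht, char_transvection_eq_one hnF χ hij c t ht⟩
    · exact ⟨1, rfl, map_one χ⟩
    · rintro _ _ _ _ ⟨x, rfl, hx⟩ ⟨y, rfl, hy⟩
      exact ⟨x * y, rfl, by rw [map_mul, hx, hy, mul_one]⟩
  obtain ⟨g', h1, h2⟩ := key
  rwa [Units.ext h1] at h2

/-- Except for `GL 2` over the field of two elements, characters factor through the determinant. -/
theorem exists_char_eq_det (hnF : ¬(n = 2 ∧ Nat.card F = 2)) (χ : GL (Fin n) F →* ℂˣ) :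
    ∃ ψ : Fˣ →* ℂˣ, ∀ g, χ g = ψ g.det := by
  rcases n with _ | n
  · refine ⟨1, fun g => ?_⟩
    rw [Subsingleton.elim g 1, map_one]
    rfl
  · refine ⟨χ.comp (diagUnit 0), fun g => ?_⟩
    have h1 : χ (g * (diagUnit 0 g.det)⁻¹) = 1 := by
      refine char_eq_one_of_det hnF χ _ ?_
      change ((g * (diagUnit 0 g.det)⁻¹).det : F) = 1
      rw [map_mul, map_inv, det_diagUnit, mul_inv_cancel, Units.val_one]
    rw [map_mul, map_inv, mul_inv_eq_one] at h1
    exact h1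

end Characters

section FunctionSpaces

variable {F : Type*} [Field F] {m k N : ℕ}

theorem StdBlock.rowIdx_ne_colIdx (U : StdBlock m) (i : Fin U.a) (j : Fin U.b) :
    U.rowIdx i ≠ U.colIdx j := by
  intro h
  have h' := congrArg Fin.val h
  simp only [rowIdx, colIdx] at h'
  have := U.row_le
  omega

theorem StdBlock.det_elem (U : StdBlock m) (X : Matrix (Fin U.a) (Fin U.b) F) :
    (U.elem X).det = 1 := by
  ext
  change (1 + U.place X).det = 1
  rw [U.place_eq]
  exact det_one_add_inc (fun i j => (U.rowIdx_ne_colIdx i j).symm) X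

/-- The representation of `GL m` on a finite sum of spaces of functions of `k` vectors, twisted by
characters `ψ j` of the determinant. -/
def twistedFun (m k : ℕ) (ψ : Fin N → Fˣ →* ℂˣ) :
    Representation ℂ (GL (Fin m) F) (Fin N → (Fin k → Fin m → F) → ℂ) where
  toFun g := LinearMap.pi fun j =>
    twist ((ψ j).comp GeneralLinearGroup.det) (permFun F m k) g ∘ₗ LinearMap.proj j
  map_one' := by ext; simp
  map_mul' g h := by ext; simp

theorem twistedFun_apply (ψ : Fin N → Fˣ →* ℂˣ) (g : GL (Fin m) F)
    (f : Fin N → (Fin k → Fin m → F) → ℂ) (j : Fin N) (y : Fin k → Fin m → F) :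
    twistedFun m k ψ g f j y =
      (ψ j g.det : ℂ) * f j fun i => (g⁻¹ : GL (Fin m) F).val *ᵥ y i :=
  rfl

theorem rank_le_of_forall_trace {χ₀ : AddChar F ℂ} (hχ₀ : χ₀ ≠ 1) {a b c : Type*} [Fintype a]
    [Fintype b] [Fintype c] {T : Matrix b a F} {Y : Matrix b c F}
    (h : ∀ X : Matrix a b F, X * Y = 0 → χ₀ (T * X).trace = 1) : T.rank ≤ Y.rank := by
  classical
  obtain ⟨r, hr, C, D, C', D', hY, hC, -⟩ := exists_rank_factorization Y
  -- The matrices `X = Z * (1 - C * C')` annihilate `Y`.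
  have h1 : (1 - C * C') * T = 0 := by
    by_contra h0
    obtain ⟨Z, hZ⟩ := exists_trace_ne_one hχ₀ h0
    refine hZ ?_
    rw [← Matrix.mul_assoc, trace_mul_comm]
    refine h _ ?_
    simp [hY, Matrix.mul_sub, Matrix.sub_mul, Matrix.mul_assoc, mul_mul_of_mul_eq hC]
  rw [Matrix.sub_mul, Matrix.one_mul, sub_eq_zero, Matrix.mul_assoc] at h1
  rw [h1, ← hr]
  calc (C * (C' * T)).rank ≤ C.rank := rank_mul_le_left _ _
    _ ≤ r := by simpa using C.rank_le_card_width

/-- In a space of functions of `k` vectors only characters of rank at most `k` appear: the unipotent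
elements that fix the point `y` act on the value of a function at `y` trivially. -/
theorem rank_le_of_charAppears {χ₀ : AddChar F ℂ} (hχ₀ : χ₀ ≠ 1) {ψ : Fin N → Fˣ →* ℂˣ}
    {U : StdBlock m} {T : Matrix (Fin U.b) (Fin U.a) F}
    (h : CharAppears χ₀ (twistedFun m k ψ) U T) : T.rank ≤ k := by
  obtain ⟨v, hv, hT⟩ := h
  obtain ⟨j, hj⟩ := Function.ne_iff.1 hv
  obtain ⟨y, hy⟩ := Function.ne_iff.1 hj
  let Y : Matrix (Fin U.b) (Fin k) F := of fun c i => y i (U.colIdx c)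
  refine (rank_le_of_forall_trace hχ₀ (Y := Y) fun X hX => ?_).trans (by
    simpa using Y.rank_le_card_width)
  have h1 := congrFun (congrFun (hT X) j) y
  rw [twistedFun_apply, U.det_elem, map_one, Units.val_one, one_mul] at h1
  have h2 : (fun i => ((U.elem X)⁻¹ : GL (Fin m) F).val *ᵥ y i) = y := by
    funext i
    change (1 + U.place (-X)) *ᵥ y i = y i
    have h3 : X *ᵥ ((inc F U.colIdx)ᵀ *ᵥ y i) = 0 := by
      ext c
      have := congrFun (congrFun hX c) i
      simpa [mul_apply, mulVec, dotProduct, inc, one_apply, Y] using this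
    rw [add_mulVec, one_mulVec, U.place_neg, neg_mulVec, U.place_eq, ← mulVec_mulVec,
      ← mulVec_mulVec, h3, mulVec_zero, neg_zero, add_zero]
  rw [h2] at h1
  exact (mul_eq_right₀ hy).1 h1.symm

/-- Any finite-dimensional representation is equivalent to one on a space in the lowest universe, as
required in the definition of the asymptotic rank. -/
theorem exists_small_model {n : ℕ} {V W : Type*} [AddCommGroup V] [Module ℂ V] [AddCommGroup W]
    [Module ℂ W] [FiniteDimensional ℂ W] {χ₀ : AddChar F ℂ}
    {π : Representation ℂ (GL (Fin n) F) V} (ρ : Representation ℂ (GL (Fin m) F) W)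
    (h : n ≤ m) (hm : 2 * (k + 1) ≤ m)
    (hρ : ∀ (U : StdBlock m) (T : Matrix (Fin U.b) (Fin U.a) F), CharAppears χ₀ ρ U T → T.rank ≤ k)
    (hπ : IsContained π (ρ.comp (blockEmb F h))) :
    ∃ (W : Type) (_ : AddCommGroup W) (_ : Module ℂ W) (_ : FiniteDimensional ℂ W)
      (ρ : Representation ℂ (GL (Fin m) F) W),
      IsLowURank χ₀ ρ ∧ uRank χ₀ ρ ≤ k ∧ IsContained π (ρ.comp (blockEmb F h)) := by
  let e : W ≃ₗ[ℂ] (Fin (Module.finrank ℂ W) → ℂ) := (Module.finBasis ℂ W).equivFun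
  let ρ' : Representation ℂ (GL (Fin m) F) (Fin (Module.finrank ℂ W) → ℂ) :=
    { toFun := fun g => e.toLinearMap ∘ₗ ρ g ∘ₗ e.symm.toLinearMap
      map_one' := by ext; simp
      map_mul' := fun g g' => by ext; simp }
  have he (g : GL (Fin m) F) (v) : ρ' g v = e (ρ g (e.symm v)) := rfl
  have hU (U : StdBlock m) : rankAt χ₀ ρ' U ≤ k := by
    refine csSup_le' ?_
    rintro _ ⟨T, ⟨v, hv, hT⟩, rfl⟩
    refine hρ U T ⟨e.symm v, by simpa using hv, fun X => ?_⟩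
    rw [← map_smul, ← hT X, he, LinearEquiv.symm_apply_apply]
  obtain ⟨f, hf⟩ := hπ
  refine ⟨_, inferInstance, inferInstance, inferInstance, ρ',
    ⟨⟨k + 1, k + 1, 0, k + 1, by omega, by omega⟩, ?_⟩, csSup_le' ?_,
    LinearMap.intertwiningMap_of_isIntertwiningMap _ _ (e.toLinearMap ∘ₗ f.toLinearMap)
      fun g v => ?_, e.injective.comp hf⟩
  · rw [min_self]
    exact Nat.lt_succ_of_le (hU _)
  · rintro _ ⟨U, rfl⟩
    exact hU U
  · change e (f (π g v)) = ρ' (blockEmb F h g) (e (f v))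
    rw [he, LinearEquiv.symm_apply_apply, f.isIntertwining]
    rfl

end FunctionSpaces

section Ascent

variable {F : Type*} [Field F] {n k : ℕ}

theorem det_blockEmb {m : ℕ} (h : n ≤ m) (g : GL (Fin n) F) : (blockEmb F h g).det = g.det := by
  ext
  change (blockEmb F h g).val.det = g.val.det
  rw [blockEmb_eq_emb, emb, Matrix.mul_assoc, det_one_add_mul_comm, Matrix.mul_assoc,
    (frame_blockIdx h).aa, Matrix.mul_one, add_sub_cancel]

theorem blockEmb_mulVec {m : ℕ} (h : n ≤ m) (g : GL (Fin n) F) (y : Fin m → F) :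
    ((blockEmb F h g).val *ᵥ y) ∘ blockIdx h ∘ Sum.inl = g.val *ᵥ (y ∘ blockIdx h ∘ Sum.inl) := by
  have h1 (z : Fin m → F) : z ∘ blockIdx h ∘ Sum.inl =
      (inc F (blockIdx h ∘ Sum.inl))ᵀ *ᵥ z := by
    ext i
    simp [inc, mulVec, dotProduct, one_apply]
  rw [h1, h1, mulVec_mulVec, mulVec_mulVec, blockEmb_eq_emb, self_mul_emb (frame_blockIdx h).aa]

variable [Finite F] {V : Type*} [AddCommGroup V] [Module ℂ V] [FiniteDimensional ℂ V]

/-- Small tensor rank implies small asymptotic rank. The components of the representation of `GL n`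
embed in twisted spaces of functions of `k` vectors in `F^n`, and such functions extend to
functions of `k` vectors in `F^m`. -/
theorem asymptoticRankLE_of_tensorRankLE {χ₀ : AddChar F ℂ} (hχ₀ : χ₀ ≠ 1)
    (hnF : ¬(n = 2 ∧ Nat.card F = 2)) {π : Representation ℂ (GL (Fin n) F) V}
    (h : TensorRankLE π k) : AsymptoticRankLE χ₀ π k := by
  obtain ⟨N, τ, p, hτ, hp⟩ := exists_decomposition π
  choose χ f hf using fun j => exists_permFun_of_irrTensorRankLE (h (τ j) (hτ j))
  choose ψ hψ using fun j => exists_char_eq_det hnF (χ j)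
  refine ⟨n + 2 * (k + 1), fun m hm => ⟨by omega, ?_⟩⟩
  have hnm : n ≤ m := by omega
  refine exists_small_model (twistedFun m k ψ) hnm (by omega)
    (fun U T hT => rank_le_of_charAppears hχ₀ hT) ?_
  refine ⟨LinearMap.intertwiningMap_of_isIntertwiningMap _ _
    (LinearMap.pi fun j =>
      (LinearMap.funLeft ℂ ℂ fun (y : Fin k → Fin m → F) i => y i ∘ blockIdx hnm ∘ Sum.inl) ∘ₗ
        (f j).toLinearMap ∘ₗ (p j).toLinearMap) fun g v => ?_, ?_⟩
  · funext j y
    change f j (p j (π g v)) (fun i => y i ∘ blockIdx hnm ∘ Sum.inl) =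
      (ψ j (blockEmb F hnm g).det : ℂ) * f j (p j v) fun i =>
        (((blockEmb F hnm g)⁻¹ : GL (Fin m) F).val *ᵥ y i) ∘ blockIdx hnm ∘ Sum.inl
    rw [(p j).isIntertwining, (f j).isIntertwining, twist_apply, Pi.smul_apply, smul_eq_mul,
      permFun_apply, det_blockEmb, hψ, ← map_inv]
    simp only [blockEmb_mulVec]
  · rw [injective_iff_map_eq_zero]
    intro v hv
    have h1 (j : Fin N) : p j v = 0 := by
      apply hf j
      rw [map_zero]
      refine LinearMap.funLeft_injective_of_surjective ℂ ℂ
        (fun (y : Fin k → Fin m → F) i => y i ∘ blockIdx hnm ∘ Sum.inl) ?_ (congrFun hv j)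
      intro y
      refine ⟨fun i q => Sum.elim (y i) 0 ((blockIdx hnm).symm q), ?_⟩
      ext i q
      simp
    rw [← hp v]
    simp [h1]

end Ascent

end GLRank

theorem theorem11p4 {F : Type*} [Field F] [Finite F] (χ₀ : AddChar F ℂ) (hχ₀ : χ₀ ≠ 1)
    (n : ℕ) (hnF : ¬(n = 2 ∧ Nat.card F = 2))
    {V : Type*} [AddCommGroup V] [Module ℂ V] [FiniteDimensional ℂ V]
    (π : Representation ℂ (GL (Fin n) F) V) :
    GLRank.asymptoticRank χ₀ π = GLRank.tensorRank π := by
  have h (k : ℕ) : GLRank.AsymptoticRankLE χ₀ π k ↔ GLRank.TensorRankLE π k :=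
    ⟨GLRank.tensorRankLE_of_asymptoticRankLE hχ₀, GLRank.asymptoticRankLE_of_tensorRankLE hχ₀ hnF⟩
  simp only [GLRank.asymptoticRank, GLRank.tensorRank, h]
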